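/- **Pinning Lemma.** Let $A \in \mathbb{C}^{m\times m}$ be a Hermitian matrix with algebraic entries and let $D \in \mathbb{R}^{m\times m}$ be a diagonal matrix whose diagonal entries are positive algebraic numbers. For a directed graph $G=(V,E)$, possibly with multiple edges and loops, and a pinning $\phi$, i.e. a map $\phi : W \to [m]$ on a subset $W\subseteq V$, put $$Z_{A,D}(\phi,G)=\sum_{\phi\subseteq\xi:V\to[m]}\ \prod_{uv\in E}A_{\xi(u),\xi(v)}\prod_{v\in V\setminus W}D_{\xi(v),\xi(v)},$$ where the sum is over all maps $\xi:V\to[m]$ that extend $\phi$. Let $\mathrm{EVAL}^{\mathsf{pin}}(A,D)$ be the problem of computing $Z_{A,D}(\phi,G)$ on input $(G,\phi)$, and let $\mathrm{EVAL}(A,D)$ be its restriction to inputs with empty pinning. The matrices $A,D$ are fixed. Digraphs are given by the list of their vertices and the list of their edges (with repetitions), and numbers are given in standard representation in a fixed number field $\mathbb{Q}(\theta)$ that contains all entries of $A$ and $D$, i.e. by their rational coordinates (in lowest terms, in binary) in the basis $1,\theta,\dots,\theta^{d-1}$, $d=[\mathbb{Q}(\theta):\mathbb{Q}]$. Then such a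 $\theta$ exists, and for every such $\theta$ the problems $\mathrm{EVAL}^{\mathsf{pin}}(A,D)$ and $\mathrm{EVAL}(A,D)$ are polynomial-time equivalent: each of them can be solved by a polynomial-time algorithm with an oracle for the other one. -/

import Mathlib

/-!
Polynomial-time reducibility between evaluation problems, and the evaluation problems of
partition functions with and without pinned vertices.

The machine model is that of while-programs with an oracle, on finitely many registers which hold
nested pairs of integers.  Time is measured by the logarithmic cost criterion: each operation is
charged the total bit length of its operands and of its result, copying a register is charged the
bit length of its contents, and an oracle call is charged the bit lengths of the query and of the
answer.  Up to a polynomial this is the time of a multitape oracle Turing machine.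
-/

namespace PartitionFunction

/-! ### Data, programs and their running time -/

/-- Data: binary trees with integers at the leaves. -/
inductive Val : Type
  | int : ℤ → Val
  | pair : Val → Val → Val
  deriving DecidableEq

namespace Val

/-- The description length: an integer counts with its number of binary digits. -/
def size : Val → ℕ
  | int z => 1 + Nat.size z.natAbs
  | pair a b => 1 + a.size + b.size

/-- The integer at a leaf (`0` at a pair). -/
def toInt : Val → ℤ
  | int z => z
  | pair _ _ => 0

def fst : Val → Val
  | int _ => int 0
  | pair a _ => a

def snd : Val → Val
  | int _ => int 0
  | pair _ b => b

/-- Truth values are `1` and `0`. -/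
def ofBool (b : Bool) : Val := int (if b then 1 else 0)

def isPair : Val → Bool
  | int _ => false
  | pair _ _ => true

/-- Lists are nested pairs, closed by the integer `0`. -/
def ofList : List Val → Val
  | [] => int 0
  | a :: l => pair a (ofList l)

end Val

/-- The contents of the registers. -/
abbrev State : Type := ℕ → Val

/-- Expressions. -/
inductive Expr : Type
  | const : ℤ → Expr
  | reg : ℕ → Expr
  | pair : Expr → Expr → Expr
  | fst : Expr → Expr
  | snd : Expr → Expr
  | isPair : Expr → Expr
  | eq : Expr → Expr → Expr
  | lt : Expr → Expr → Expr
  | add : Expr → Expr → Expr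
  | sub : Expr → Expr → Expr
  | mul : Expr → Expr → Expr
  /-- Integer quotient, with value `0` if the divisor is `0`. -/
  | div : Expr → Expr → Expr

namespace Expr

/-- The value of an expression. -/
def eval (s : State) : Expr → Val
  | const z => .int z
  | reg x => s x
  | pair e f => .pair (e.eval s) (f.eval s)
  | fst e => (e.eval s).fst
  | snd e => (e.eval s).snd
  | isPair e => .ofBool (e.eval s).isPair
  | eq e f => .ofBool (decide (e.eval s = f.eval s))
  | lt e f => .ofBool (decide ((e.eval s).toInt < (f.eval s).toInt))
  | add e f => .int ((e.eval s).toInt + (f.eval s).toInt)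
  | sub e f => .int ((e.eval s).toInt - (f.eval s).toInt)
  | mul e f => .int ((e.eval s).toInt * (f.eval s).toInt)
  | div e f => .int ((e.eval s).toInt / (f.eval s).toInt)

/-- The time to evaluate an expression: the sum of `1` plus the description length of the value,
over all its subexpressions. -/
def cost (s : State) : Expr → ℕ
  | const z => 1 + (Val.int z).size
  | reg x => 1 + (s x).size
  | pair e f => e.cost s + f.cost s + 1 + ((pair e f).eval s).size
  | fst e => e.cost s + 1 + ((fst e).eval s).size
  | snd e => e.cost s + 1 + ((snd e).eval s).size
  | isPair e => e.cost s + 1 + ((isPair e).eval s).size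
  | eq e f => e.cost s + f.cost s + 1 + ((eq e f).eval s).size
  | lt e f => e.cost s + f.cost s + 1 + ((lt e f).eval s).size
  | add e f => e.cost s + f.cost s + 1 + ((add e f).eval s).size
  | sub e f => e.cost s + f.cost s + 1 + ((sub e f).eval s).size
  | mul e f => e.cost s + f.cost s + 1 + ((mul e f).eval s).size
  | div e f => e.cost s + f.cost s + 1 + ((div e f).eval s).size

end Expr

/-- Programs.  `query x e` replaces the contents of register `x` by the answer of the oracle to
the value of `e`.  A condition holds if its value is not the integer `0`. -/
inductive Program : Type
  | skip : Program
  | assign : ℕ → Expr → Program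
  | seq : Program → Program → Program
  | ite : Expr → Program → Program → Program
  | while : Expr → Program → Program
  | query : ℕ → Expr → Program

/-- `Exec O c s s' t`: with the oracle `O`, the program `c` started in the state `s` halts in the
state `s'` after time `t`. -/
inductive Exec (O : Val → Val) : Program → State → State → ℕ → Prop
  | skip (s : State) : Exec O .skip s s 1
  | assign (s : State) (x : ℕ) (e : Expr) :
      Exec O (.assign x e) s (Function.update s x (e.eval s)) (1 + e.cost s)
  | seq {c d : Program} {s s' s'' : State} {t t' : ℕ} :
      Exec O c s s' t → Exec O d s' s'' t' → Exec O (.seq c d) s s'' (1 + t + t')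
  | iteTrue {e : Expr} {c d : Program} {s s' : State} {t : ℕ} :
      e.eval s ≠ .int 0 → Exec O c s s' t → Exec O (.ite e c d) s s' (1 + e.cost s + t)
  | iteFalse {e : Expr} {c d : Program} {s s' : State} {t : ℕ} :
      e.eval s = .int 0 → Exec O d s s' t → Exec O (.ite e c d) s s' (1 + e.cost s + t)
  | whileTrue {e : Expr} {c : Program} {s s' s'' : State} {t t' : ℕ} :
      e.eval s ≠ .int 0 → Exec O c s s' t → Exec O (.while e c) s' s'' t' →
      Exec O (.while e c) s s'' (1 + e.cost s + t + t')
  | whileFalse {e : Expr} {c : Program} {s : State} :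
      e.eval s = .int 0 → Exec O (.while e c) s s (1 + e.cost s)
  | query (s : State) (x : ℕ) (e : Expr) :
      Exec O (.query x e) s (Function.update s x (O (e.eval s)))
        (1 + e.cost s + (O (e.eval s)).size)

/-- At the start, register `0` holds the input and every other register holds the integer `0`. -/
def initState (v : Val) : State := fun x => if x = 0 then v else .int 0

/-! ### Problems and polynomial-time reductions -/

/-- A computational problem: a type of instances, their encoding, and for each instance the data
that are accepted as an answer. -/
structure Problem where
  Instance : Type
  encode : Instance → Val
  IsAnswer : Instance → Val → Prop

/-- The oracle `O` answers every instance of `P` correctly. -/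
def Problem.SolvedBy (P : Problem) (O : Val → Val) : Prop :=
  ∀ x : P.Instance, P.IsAnswer x (O (P.encode x))

/-- Polynomial-time (Turing) reducibility of `P` to `Q`: one program, which halts in polynomial
time with a correct answer to the given instance of `P` in register `0`, whatever oracle for `Q`
it is run with. -/
def PolyTimeReducible (P Q : Problem) : Prop :=
  ∃ (c : Program) (p : Polynomial ℕ), ∀ O : Val → Val, Q.SolvedBy O →
    ∀ x : P.Instance, ∃ (s : State) (t : ℕ),
      Exec O c (initState (P.encode x)) s t ∧
      t ≤ p.eval (P.encode x).size ∧ P.IsAnswer x (s 0)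

/-- Polynomial-time equivalence. -/
def PolyTimeEquivalent (P Q : Problem) : Prop :=
  PolyTimeReducible P Q ∧ PolyTimeReducible Q P

/-! ### Algebraic numbers in standard representation -/

/-- A rational number is encoded by its numerator and denominator in lowest terms. -/
def encodeRat (q : ℚ) : Val := .pair (.int q.num) (.int q.den)

/-- `v` is the standard representation of `z` in `ℚ(θ)`: the list of the coordinates of `z` in the
basis `1, θ, …, θ ^ (d - 1)`, where `d` is the degree of `θ`. -/
def IsStandardRep (θ z : ℂ) (v : Val) : Prop :=
  ∃ c : Fin (minpoly ℚ θ).natDegree → ℚ,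
    z = ∑ i, (c i : ℂ) * θ ^ (i : ℕ) ∧ v = .ofList (List.ofFn fun i => encodeRat (c i))

/-- `θ` is algebraic, and the field `ℚ(θ)` contains all entries of `A` and `D`. -/
def IsCommonGenerator {m : ℕ} (θ : ℂ) (A : Matrix (Fin m) (Fin m) ℂ)
    (D : Matrix (Fin m) (Fin m) ℝ) : Prop :=
  IsAlgebraic ℚ θ ∧
    ∀ i j, A i j ∈ IntermediateField.adjoin ℚ {θ} ∧
      ((D i j : ℝ) : ℂ) ∈ IntermediateField.adjoin ℚ {θ}

/-! ### Partition functions -/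

/-- A directed multigraph (loops and parallel edges allowed; each edge is listed as often as its
multiplicity) on the vertices `0, …, n - 1`, together with a pinning, that is a partial map from
the vertices to the `m` indices of a matrix. -/
structure PinnedDigraph (m : ℕ) where
  n : ℕ
  edges : List (Fin n × Fin n)
  pin : Fin n → Option (Fin m)

/-- The entry of a vertex in the list of vertices: `0` if it is not pinned, and `i + 1` if it is
pinned to the index `i` (so indices are numbered from `1`). -/
def encodePin {m : ℕ} : Option (Fin m) → Val
  | none => .int 0
  | some i => .int ((i : ℕ) + 1 : ℤ)

/-- The encoding of a digraph with pinning: the list of all vertices with their pinnings, and the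
list of all edges. -/
def PinnedDigraph.encode {m : ℕ} (G : PinnedDigraph m) : Val :=
  .pair (.ofList (List.ofFn fun v => encodePin (G.pin v)))
    (.ofList (G.edges.map fun e => .pair (.int ((e.1 : ℕ) : ℤ)) (.int ((e.2 : ℕ) : ℤ))))

/-- The partition function `Z_{A,D}(φ, G)`: the sum over all configurations `ξ` that extend the
pinning; pinned vertices do not contribute a vertex weight. -/
noncomputable def partitionFunction {m : ℕ} (A D : Matrix (Fin m) (Fin m) ℂ)
    (G : PinnedDigraph m) : ℂ :=
  ∑ ξ : Fin G.n → Fin m with ∀ v i, G.pin v = some i → ξ v = i,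
    (G.edges.map fun e => A (ξ e.1) (ξ e.2)).prod *
      ∏ v : Fin G.n with G.pin v = none, D (ξ v) (ξ v)

/-- `EVAL^pin(A, D)`: given a digraph and a pinning, compute `Z_{A,D}(φ, G)`, in standard
representation in `ℚ(θ)`. -/
noncomputable def evalPin {m : ℕ} (θ : ℂ) (A : Matrix (Fin m) (Fin m) ℂ)
    (D : Matrix (Fin m) (Fin m) ℝ) : Problem where
  Instance := PinnedDigraph m
  encode := PinnedDigraph.encode
  IsAnswer G v := IsStandardRep θ (partitionFunction A (D.map Complex.ofReal) G) v

/-- `EVAL(A, D)`: the restriction of `EVAL^pin(A, D)` to inputs with empty pinning. -/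
noncomputable def evalNoPin {m : ℕ} (θ : ℂ) (A : Matrix (Fin m) (Fin m) ℂ)
    (D : Matrix (Fin m) (Fin m) ℝ) : Problem where
  Instance := {G : PinnedDigraph m // ∀ v, G.pin v = none}
  encode G := G.1.encode
  IsAnswer G v := IsStandardRep θ (partitionFunction A (D.map Complex.ofReal) G.1) v

end PartitionFunction

/-! The trivial direction is one query, affordable because every correct answer has length linear in
that of the input. For this bound, a common denominator `K` and a height bound `C` are fixed for the
matrix entries and for the structure constants of the power basis; denominators and coordinates of a
partition function are then at most powers of `K` and `C` with exponent linear in the size of the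
graph (`exists_size_partitionFunction_le`).

For the other direction, consider graphs with `m` labelled vertices. Each defines a function of the
assignment `ψ : [m] → [m]` of its labels, and gluing along labels multiplies these functions
(`labelledSum_glue`). Their linear span is therefore an algebra of functions on a finite set, so it
contains the indicator of the set `S` of all `ψ` that no labelled graph distinguishes from the
identity (`exists_indicator`). A pinned graph is itself a labelled graph evaluated at the identity,
and its function is constant on `S`. Summing this function times the indicator, with vertex weights
on the labels, gives the pinned value times the weight of `S`, which is positive since `D` is.
Expanding the indicator turns the sum into a fixed linear combination of unpinned partition
functions of `G` glued with constantly many fixed graphs (`exists_pinning_combination`). Neither `S`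
nor the coefficients need to be computed: they are constants of the program.

It remains to implement this. `Realizes` is a Hoare logic with polynomial time bounds, uniform in
oracle and input. The program renumbers the vertices, queries the glued graphs, combines the answers
coordinatewise, and reduces the fractions by Euclid's algorithm. -/

namespace PartitionFunction

/-! ### Labelled graphs -/

section Labelled

variable {R : Type*} [CommSemiring R] {m : ℕ} {V W : Type*} [Fintype V] [DecidableEq V] [Fintype W] [DecidableEq W]

/-- The partition function of a graph on the labelled vertices `Fin m` and the vertices `V`, for
the assignment `ψ` of indices to the labelled vertices. Labelled vertices carry no weight. -/
def labelledSum (A D : Matrix (Fin m) (Fin m) R) (E : List ((Fin m ⊕ V) × (Fin m ⊕ V)))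
    (ψ : Fin m → Fin m) : R :=
  ∑ ξ : V → Fin m, (E.map fun e => A (Sum.elim ψ ξ e.1) (Sum.elim ψ ξ e.2)).prod *
    ∏ v, D (ξ v) (ξ v)

/-- The union of two labelled graphs, with the labelled vertices identified. -/
def glue (E : List ((Fin m ⊕ V) × (Fin m ⊕ V))) (F : List ((Fin m ⊕ W) × (Fin m ⊕ W))) :
    List ((Fin m ⊕ (V ⊕ W)) × (Fin m ⊕ (V ⊕ W))) :=
  F.map (Prod.map (Sum.map id Sum.inr) (Sum.map id Sum.inr)) ++
    E.map (Prod.map (Sum.map id Sum.inl) (Sum.map id Sum.inl))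

/-- Once `ψ` is fixed the two graphs share no free vertex, so the sum over pairs of configurations
factors. Weightless labels keep the shared vertices from being counted twice. -/
theorem labelledSum_glue (A D : Matrix (Fin m) (Fin m) R)
    (E : List ((Fin m ⊕ V) × (Fin m ⊕ V))) (F : List ((Fin m ⊕ W) × (Fin m ⊕ W)))
    (ψ : Fin m → Fin m) :
    labelledSum A D (glue E F) ψ = labelledSum A D E ψ * labelledSum A D F ψ := by
  classical
  unfold labelledSum glue
  rw [Finset.sum_mul_sum, ← Finset.sum_product', Finset.univ_product_univ,
    ← (Equiv.sumArrowEquivProdArrow V W (Fin m)).sum_comp]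
  refine Finset.sum_congr rfl fun ξ _ => ?_
  have h1 : ∀ x : Fin m ⊕ V, Sum.elim ψ ξ (Sum.map id Sum.inl x) =
      Sum.elim ψ (fun v => ξ (Sum.inl v)) x := by rintro (x | x) <;> rfl
  have h2 : ∀ x : Fin m ⊕ W, Sum.elim ψ ξ (Sum.map id Sum.inr x) =
      Sum.elim ψ (fun v => ξ (Sum.inr v)) x := by rintro (x | x) <;> rfl
  simp only [List.map_append, List.map_map, List.prod_append, Fintype.prod_sum_type,
    Function.comp_def, Prod.map_fst, Prod.map_snd, h1, h2, Equiv.sumArrowEquivProdArrow,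
    Equiv.coe_fn_mk]
  ring

theorem labelledSum_map_equiv (A D : Matrix (Fin m) (Fin m) R) (f : V ≃ W)
    (E : List ((Fin m ⊕ V) × (Fin m ⊕ V))) (ψ : Fin m → Fin m) :
    labelledSum A D (E.map (Prod.map (Sum.map id f) (Sum.map id f))) ψ = labelledSum A D E ψ := by
  classical
  unfold labelledSum
  rw [← (Equiv.arrowCongr f (Equiv.refl (Fin m))).sum_comp]
  refine Finset.sum_congr rfl fun ξ _ => ?_
  have h1 : ∀ x : Fin m ⊕ V, Sum.elim ψ (fun w => ξ (f.symm w)) (Sum.map id f x) =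
      Sum.elim ψ ξ x := by rintro (x | x) <;> simp
  have h2 : ∏ w, D (ξ (f.symm w)) (ξ (f.symm w)) = ∏ v, D (ξ v) (ξ v) :=
    f.symm.prod_comp (fun v => D (ξ v) (ξ v))
  have h0 : Equiv.arrowCongr f (Equiv.refl (Fin m)) ξ = fun w => ξ (f.symm w) := rfl
  simp only [List.map_map, Function.comp_def, Prod.map_fst, Prod.map_snd, h0, h1, h2]

/-- Needed because the program collects renumbered edges at the head of a list and so reverses their
order. -/
theorem labelledSum_reverse (A D : Matrix (Fin m) (Fin m) R)
    (E : List ((Fin m ⊕ V) × (Fin m ⊕ V))) (ψ : Fin m → Fin m) :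
    labelledSum A D E.reverse ψ = labelledSum A D E ψ := by
  simp only [labelledSum, List.map_reverse, List.prod_reverse]

theorem labelledSum_nil_fin_zero (A D : Matrix (Fin m) (Fin m) R) (ψ : Fin m → Fin m) :
    labelledSum (V := Fin 0) A D [] ψ = 1 := by
  simp [labelledSum]

theorem map_labelledSum {S : Type*} [CommSemiring S] (f : R →+* S)
    (A D : Matrix (Fin m) (Fin m) R) (E : List ((Fin m ⊕ V) × (Fin m ⊕ V))) (ψ : Fin m → Fin m) :
    f (labelledSum A D E ψ) = labelledSum (A.map f) (D.map f) E ψ := by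
  simp [labelledSum, map_list_prod, Function.comp_def]

end Labelled

/-! ### Isolating the identity labelling by a linear combination of labelled graphs -/

/-- A finite family of elements of an algebra of functions on a finite set that suffices to
express the indicator function of a fibre. -/
theorem exists_indicator {K ι X : Type*} [Field K] [Fintype X] (z : ι → X → K)
    (one : ∃ i, z i = 1) (mul : ∀ i j, ∃ k, z k = z i * z j) (x₀ : X) :
    ∃ (n : ℕ) (c : ℕ → K) (H : ℕ → ι), ∀ x,
      ((∀ i, z i x = z i x₀) → ∑ j ∈ Finset.range n, c j * z (H j) x = 1) ∧
      ((¬ ∀ i, z i x = z i x₀) → ∑ j ∈ Finset.range n, c j * z (H j) x = 0) := by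
  classical
  let M : Submonoid (X → K) :=
    { carrier := Set.range z
      one_mem' := by obtain ⟨i, hi⟩ := one; exact ⟨i, hi⟩
      mul_mem' := by
        rintro _ _ ⟨i, rfl⟩ ⟨j, rfl⟩
        obtain ⟨k, hk⟩ := mul i j
        exact ⟨k, hk⟩ }
  let S := Algebra.adjoin K (M : Set (X → K))
  -- Since `M` is closed under products, the algebra it generates is only its linear span;
  -- polynomials in the `z i` become linear combinations.
  have hS : ∀ f ∈ S, f ∈ Submodule.span K (Set.range z) := by
    intro f hf
    have : f ∈ Subalgebra.toSubmodule S := hf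
    rw [Algebra.adjoin_eq_span, Submonoid.closure_eq] at this
    exact this
  have hz : ∀ i, z i ∈ S := fun i => Algebra.subset_adjoin ⟨i, rfl⟩
  -- For each point off the fibre, an affine function of a separating `z i` is `1` on the fibre and
  -- vanishes at that point. The product over all points is the indicator.
  have key : ∀ x, ∃ f ∈ S, (∀ y, (∀ i, z i y = z i x₀) → f y = 1) ∧
      ((¬ ∀ i, z i x = z i x₀) → f x = 0) := by
    intro x
    by_cases hx : ∀ i, z i x = z i x₀
    · exact ⟨1, S.one_mem, fun _ _ => rfl, fun h => absurd hx h⟩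
    · push Not at hx
      obtain ⟨i, hi⟩ := hx
      refine ⟨(z i x₀ - z i x)⁻¹ • (z i - algebraMap K (X → K) (z i x)),
        S.smul_mem (S.sub_mem (hz i) (S.algebraMap_mem _)) _, fun y hy => ?_, fun _ => ?_⟩
      · simp [hy i, inv_mul_cancel₀ (sub_ne_zero.mpr (Ne.symm hi))]
      · simp
  choose f hf h1 h0 using key
  have hprod : ∏ x, f x ∈ S := S.prod_mem fun x _ => hf x
  obtain ⟨n, c, g, hg⟩ := Submodule.mem_span_set'.mp (hS _ hprod)
  choose H hH using fun j => (g j).2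
  obtain ⟨i₀, -⟩ := one
  refine ⟨n, fun j => if h : j < n then c ⟨j, h⟩ else 0,
    fun j => if h : j < n then H ⟨j, h⟩ else i₀, fun x => ?_⟩
  have hx : ∑ j ∈ Finset.range n, (if h : j < n then c ⟨j, h⟩ else 0) *
      z (if h : j < n then H ⟨j, h⟩ else i₀) x = ∏ y, f y x := by
    rw [Finset.sum_range]
    have := congrFun hg x
    simpa [hH] using this
  rw [hx]
  exact ⟨fun h => Finset.prod_eq_one fun y _ => h1 y x h,
    fun h => Finset.prod_eq_zero (Finset.mem_univ x) (h0 x h)⟩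

/-- The value of the identity labelling as a linear combination, with constant coefficients, of
the unpinned partition functions of unions with constant labelled graphs. -/
theorem exists_pinning_combination {K : Type*} [Field K] {m : ℕ} (A D : Matrix (Fin m) (Fin m) K)
    (hD : ∀ S : Finset (Fin m → Fin m), S.Nonempty → ∑ ψ ∈ S, ∏ i, D (ψ i) (ψ i) ≠ 0) :
    ∃ (n : ℕ) (c : ℕ → K) (H : ℕ → Σ h : ℕ, List ((Fin m ⊕ Fin h) × (Fin m ⊕ Fin h))),
      ∀ (V : Type) [Fintype V] [DecidableEq V] (E : List ((Fin m ⊕ V) × (Fin m ⊕ V))),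
        labelledSum A D E id =
          ∑ j ∈ Finset.range n, c j * ∑ ψ : Fin m → Fin m,
            (∏ i, D (ψ i) (ψ i)) * labelledSum A D (glue E (H j).2) ψ := by
  classical
  obtain ⟨n, c, H, hc⟩ := exists_indicator (X := Fin m → Fin m)
    (ι := Σ h : ℕ, List ((Fin m ⊕ Fin h) × (Fin m ⊕ Fin h)))
    (fun p ψ => labelledSum A D p.2 ψ)
    ⟨⟨0, []⟩, by funext ψ; exact labelledSum_nil_fin_zero A D ψ⟩
    -- Closure under products is gluing, followed by renumbering the free vertices to stay within
    -- the types `Fin h`.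
    (fun p q => ⟨⟨p.1 + q.1, (glue p.2 q.2).map
      (Prod.map (Sum.map id finSumFinEquiv) (Sum.map id finSumFinEquiv))⟩, by
        funext ψ
        simp only [Pi.mul_apply]
        rw [labelledSum_map_equiv, labelledSum_glue]⟩) id
  let S : Finset (Fin m → Fin m) := Finset.univ.filter fun ψ =>
    ∀ p : Σ h : ℕ, List ((Fin m ⊕ Fin h) × (Fin m ⊕ Fin h)),
      labelledSum A D p.2 ψ = labelledSum A D p.2 id
  have hW := hD S ⟨id, by simp [S]⟩
  set w := ∑ ψ ∈ S, ∏ i, D (ψ i) (ψ i) with hw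
  refine ⟨n, fun j => w⁻¹ * c j, H, fun V _ _ E => ?_⟩
  -- The input graph is, up to renumbering, one of the graphs that define `S`, so its function
  -- cannot vary on `S`.
  have hE : ∀ ψ ∈ S, labelledSum A D E ψ = labelledSum A D E id := by
    intro ψ hψ
    have := (Finset.mem_filter.mp hψ).2
      ⟨Fintype.card V, E.map (Prod.map (Sum.map id (Fintype.equivFin V))
        (Sum.map id (Fintype.equivFin V)))⟩
    simpa only [labelledSum_map_equiv] using this
  have : ∑ j ∈ Finset.range n, c j * ∑ ψ : Fin m → Fin m,
      (∏ i, D (ψ i) (ψ i)) * labelledSum A D (glue E (H j).2) ψ = w * labelledSum A D E id := by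
    calc _ = ∑ ψ : Fin m → Fin m, (∏ i, D (ψ i) (ψ i)) * labelledSum A D E ψ *
          ∑ j ∈ Finset.range n, c j * labelledSum A D (H j).2 ψ := by
          simp only [Finset.mul_sum]
          rw [Finset.sum_comm]
          refine Finset.sum_congr rfl fun ψ _ => Finset.sum_congr rfl fun j _ => ?_
          rw [labelledSum_glue]; ring
      _ = ∑ ψ ∈ S, (∏ i, D (ψ i) (ψ i)) * labelledSum A D E ψ := by
          rw [Finset.sum_filter]
          refine Finset.sum_congr rfl fun ψ _ => ?_
          split_ifs with hψ
          · rw [(hc ψ).1 hψ, mul_one]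
          · rw [(hc ψ).2 hψ, mul_zero]
      _ = w * labelledSum A D E id := by
          rw [hw, Finset.sum_mul]
          exact Finset.sum_congr rfl fun ψ hψ => by rw [hE ψ hψ]
  simp only [mul_assoc, ← Finset.mul_sum]
  rw [this, inv_mul_cancel_left₀ hW]

/-! ### Partition functions of labelled graphs -/

/-- A vertex pinned to `i` becomes the labelled vertex `i`. -/
def PinnedDigraph.label {m : ℕ} (G : PinnedDigraph m) (v : Fin G.n) :
    Fin m ⊕ {v : Fin G.n // G.pin v = none} :=
  match h : G.pin v with
  | none => .inr ⟨v, h⟩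
  | some i => .inl i

theorem PinnedDigraph.label_of_some {m : ℕ} (G : PinnedDigraph m) {v : Fin G.n} {i : Fin m}
    (h : G.pin v = some i) : G.label v = .inl i := by
  unfold label
  split
  · simp_all
  · simp_all

theorem PinnedDigraph.label_of_none {m : ℕ} (G : PinnedDigraph m) {v : Fin G.n}
    (h : G.pin v = none) : G.label v = .inr ⟨v, h⟩ := by
  unfold label
  split
  · rfl
  · simp_all

/-- The labelled graph obtained from a digraph with pinning by identifying the vertices pinned to
the same index. -/
def PinnedDigraph.labelledEdges {m : ℕ} (G : PinnedDigraph m) :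
    List ((Fin m ⊕ {v : Fin G.n // G.pin v = none}) ×
      (Fin m ⊕ {v : Fin G.n // G.pin v = none})) :=
  G.edges.map (Prod.map G.label G.label)

/-- Extensions of the pinning correspond to free assignments of the unpinned vertices. Vertices
pinned to one index may be merged because they always take the same value and carry no weight. -/
theorem partitionFunction_eq_labelledSum {m : ℕ} (A D : Matrix (Fin m) (Fin m) ℂ)
    (G : PinnedDigraph m) :
    partitionFunction A D G = labelledSum A D G.labelledEdges id := by
  classical
  unfold partitionFunction labelledSum
  refine Finset.sum_bij' (fun ξ _ v => ξ v.1) (fun ξ _ v => Sum.elim id ξ (G.label v))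
    (fun _ _ => Finset.mem_univ _) ?_ ?_ ?_ ?_
  · intro ξ _
    simp only [Finset.mem_filter, Finset.mem_univ, true_and]
    intro v i h
    simp [G.label_of_some h]
  · intro ξ hξ
    simp only [Finset.mem_filter, Finset.mem_univ, true_and] at hξ
    funext v
    cases h : G.pin v with
    | none => simp [G.label_of_none h]
    | some i => simp [G.label_of_some h, hξ v i h]
  · intro ξ _
    funext v
    simp [G.label_of_none v.2]
  · intro ξ hξ
    simp only [Finset.mem_filter, Finset.mem_univ, true_and] at hξ
    have h1 : ∀ v, Sum.elim id (fun v : {v : Fin G.n // G.pin v = none} => ξ v.1) (G.label v) =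
        ξ v := by
      intro v
      cases h : G.pin v with
      | none => simp [G.label_of_none h]
      | some i => simp [G.label_of_some h, hξ v i h]
    have h2 : ∏ v : Fin G.n with G.pin v = none, D (ξ v) (ξ v) =
        ∏ v : {v : Fin G.n // G.pin v = none}, D (ξ v.1) (ξ v.1) :=
      Finset.prod_subtype _ (by simp) _
    rw [h2, PinnedDigraph.labelledEdges]
    simp only [List.map_map, Function.comp_def, Prod.map_fst, Prod.map_snd, h1]

/-- The digraph without pinning on the vertices of a labelled graph, with a numbering. -/
def unpinned {m N : ℕ} {V : Type*} (f : Fin m ⊕ V ≃ Fin N)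
    (E : List ((Fin m ⊕ V) × (Fin m ⊕ V))) : PinnedDigraph m where
  n := N
  edges := E.map (Prod.map f f)
  pin := fun _ => none

/-- Forgetting the labels makes those vertices ordinary: their values are summed over and their
weights return. -/
theorem partitionFunction_unpinned {m N : ℕ} {V : Type*} [Fintype V] [DecidableEq V]
    (A D : Matrix (Fin m) (Fin m) ℂ) (f : Fin m ⊕ V ≃ Fin N)
    (E : List ((Fin m ⊕ V) × (Fin m ⊕ V))) :
    partitionFunction A D (unpinned f E) =
      ∑ ψ : Fin m → Fin m, (∏ i, D (ψ i) (ψ i)) * labelledSum A D E ψ := by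
  classical
  unfold partitionFunction labelledSum unpinned
  simp only [reduceCtorEq, false_implies, implies_true, Finset.filter_true]
  rw [← (Equiv.arrowCongr f (Equiv.refl (Fin m))).sum_comp,
    ← (Equiv.sumArrowEquivProdArrow (Fin m) V (Fin m)).symm.sum_comp, Fintype.sum_prod_type]
  refine Finset.sum_congr rfl fun ψ _ => ?_
  rw [Finset.mul_sum]
  refine Finset.sum_congr rfl fun ξ _ => ?_
  have h1 : (Equiv.sumArrowEquivProdArrow (Fin m) V (Fin m)).symm (ψ, ξ) = Sum.elim ψ ξ := rfl
  have h2 : ∏ v, D (Sum.elim ψ ξ (f.symm v)) (Sum.elim ψ ξ (f.symm v)) =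
      (∏ i, D (ψ i) (ψ i)) * ∏ v, D (ξ v) (ξ v) := by
    rw [f.symm.prod_comp (fun v => D (Sum.elim ψ ξ v) (Sum.elim ψ ξ v)), Fintype.prod_sum_type]
    rfl
  simp only [List.map_map, Function.comp_def, Prod.map_fst, Prod.map_snd, h1,
    Equiv.arrowCongr_apply, Equiv.coe_refl, id, h2, Equiv.symm_apply_apply]
  ring


/-! ### Coordinates in a number field -/

theorem exists_adjoin_eq_adjoin_simple {F E : Type*} [Field F] [CharZero F] [Field E] [Algebra F E]
    (S : Set E) [Finite S] (hS : ∀ x ∈ S, IsIntegral F x) :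
    ∃ α : E, IsAlgebraic F α ∧ IntermediateField.adjoin F S = IntermediateField.adjoin F {α} := by
  have := IntermediateField.finiteDimensional_adjoin hS
  obtain ⟨α, hα⟩ := Field.exists_primitive_element F (IntermediateField.adjoin F S)
  have h := IntermediateField.lift_adjoin_simple F (IntermediateField.adjoin F S) α
  rw [hα, IntermediateField.lift_top] at h
  exact ⟨α, (Algebra.IsAlgebraic.isAlgebraic (R := F) α).algHom
    (IntermediateField.adjoin F S).val, h⟩

theorem exists_commonGenerator {m : ℕ} (A : Matrix (Fin m) (Fin m) ℂ)
    (D : Matrix (Fin m) (Fin m) ℝ) (hA : ∀ i j, IsAlgebraic ℚ (A i j)) (hD : D.IsDiag)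
    (hDalg : ∀ i, IsAlgebraic ℚ (D i i)) : ∃ θ : ℂ, IsCommonGenerator θ A D := by
  classical
  let S : Set ℂ := Set.range (fun p : Fin m × Fin m => A p.1 p.2) ∪
    Set.range (fun p : Fin m × Fin m => ((D p.1 p.2 : ℝ) : ℂ))
  have hS : ∀ x ∈ S, IsIntegral ℚ x := by
    rintro x (⟨p, rfl⟩ | ⟨p, rfl⟩)
    · exact (hA p.1 p.2).isIntegral
    · have : IsIntegral ℚ (D p.1 p.2) := by
        by_cases h : p.1 = p.2
        · rw [← h]; exact (hDalg p.1).isIntegral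
        · rw [hD h]; exact isIntegral_zero
      exact this.map (Complex.ofRealAm.restrictScalars ℚ)
  have : Finite S := Set.Finite.to_subtype (Set.toFinite _)
  obtain ⟨α, hα, h⟩ := exists_adjoin_eq_adjoin_simple S hS
  refine ⟨α, hα, fun i j => ?_⟩
  rw [← h]
  exact ⟨IntermediateField.subset_adjoin ℚ S (Or.inl ⟨(i, j), rfl⟩),
    IntermediateField.subset_adjoin ℚ S (Or.inr ⟨(i, j), rfl⟩)⟩

theorem exists_coords {θ z : ℂ} (hθ : IsAlgebraic ℚ θ)
    (hz : z ∈ IntermediateField.adjoin ℚ {θ}) :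
    ∃ c : Fin (minpoly ℚ θ).natDegree → ℚ, z = ∑ i, (c i : ℂ) * θ ^ (i : ℕ) := by
  let pb := IntermediateField.adjoin.powerBasis hθ.isIntegral
  obtain ⟨f, hf, hz'⟩ := pb.exists_eq_aeval ⟨z, hz⟩
  have h1 : z = Polynomial.aeval θ f := by
    have := congrArg (IntermediateField.adjoin ℚ {θ}).val hz'
    rw [← Polynomial.aeval_algHom_apply] at this
    simpa [pb] using this
  refine ⟨fun i => f.coeff i, ?_⟩
  rw [h1, Polynomial.aeval_eq_sum_range' (n := (minpoly ℚ θ).natDegree) hf, Finset.sum_range]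
  simp [Rat.smul_def]

/-- Uniqueness of the standard representation is what lets a height bound on a number bound every
correct answer of an oracle. -/
theorem coords_injective {θ : ℂ} {c c' : Fin (minpoly ℚ θ).natDegree → ℚ}
    (h : ∑ i, (c i : ℂ) * θ ^ (i : ℕ) = ∑ i, (c' i : ℂ) * θ ^ (i : ℕ)) : c = c' := by
  apply linearIndependent_iff_injective_fintypeLinearCombination.mp (linearIndependent_pow (K := ℚ) θ)
  simpa [Fintype.linearCombination_apply, Rat.smul_def] using h

/-! ### Heights under sums and products -/

/-- The coordinates of `K ^ r * z` are integers of absolute value at most `C ^ s`. -/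
def HasHeight (θ : ℂ) (K C r s : ℕ) (z : ℂ) : Prop :=
  ∃ a : Fin (minpoly ℚ θ).natDegree → ℤ,
    (K : ℂ) ^ r * z = ∑ i, (a i : ℂ) * θ ^ (i : ℕ) ∧ ∀ i, |a i| ≤ (C : ℤ) ^ s

theorem HasHeight.sum {θ : ℂ} {K C r s : ℕ} {ι : Type*} (S : Finset ι) (z : ι → ℂ)
    (h : ∀ i ∈ S, HasHeight θ K C r s (z i)) (n : ℕ) (hn : S.card ≤ C ^ n) :
    HasHeight θ K C r (s + n) (∑ i ∈ S, z i) := by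
  classical
  have h' : ∀ i, ∃ a : Fin (minpoly ℚ θ).natDegree → ℤ, i ∈ S →
      (K : ℂ) ^ r * z i = ∑ k, (a k : ℂ) * θ ^ (k : ℕ) ∧ ∀ k, |a k| ≤ (C : ℤ) ^ s := by
    intro i
    by_cases hi : i ∈ S
    · obtain ⟨a, ha⟩ := h i hi
      exact ⟨a, fun _ => ha⟩
    · exact ⟨0, fun h => absurd h hi⟩
  choose a ha using h'
  refine ⟨fun k => ∑ i ∈ S, a i k, ?_, fun k => ?_⟩
  · push_cast
    simp only [Finset.mul_sum, Finset.sum_mul]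
    rw [Finset.sum_comm]
    exact Finset.sum_congr rfl fun i hi => (ha i hi).1
  · calc |∑ i ∈ S, a i k| ≤ ∑ i ∈ S, |a i k| := Finset.abs_sum_le_sum_abs _ _
      _ ≤ ∑ _i ∈ S, (C : ℤ) ^ s := Finset.sum_le_sum fun i hi => (ha i hi).2 k
      _ = S.card * (C : ℤ) ^ s := by simp
      _ ≤ (C : ℤ) ^ n * (C : ℤ) ^ s := by
          gcongr
          exact_mod_cast hn
      _ = (C : ℤ) ^ (s + n) := by ring

/-- `K` is a common denominator, and `C` a bound, for the structure constants of the powers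
of `θ`. -/
def MulBound (θ : ℂ) (K C : ℕ) : Prop :=
  ∃ t : Fin (minpoly ℚ θ).natDegree → Fin (minpoly ℚ θ).natDegree →
      Fin (minpoly ℚ θ).natDegree → ℤ,
    (∀ i j : Fin (minpoly ℚ θ).natDegree, (K : ℂ) * (θ ^ (i : ℕ) * θ ^ (j : ℕ)) = ∑ k, (t i j k : ℂ) * θ ^ (k : ℕ)) ∧
    ∀ k, ∑ i, ∑ j, |t i j k| ≤ C

/-- Multiplying two coordinate vectors and expanding the products of powers of `θ` again costs one
more factor `K` for the denominators and one more factor `C` for the structure constants. -/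
theorem HasHeight.mul {θ : ℂ} {K C r s r' s' : ℕ} {z z' : ℂ} (hm : MulBound θ K C)
    (h : HasHeight θ K C r s z) (h' : HasHeight θ K C r' s' z') :
    HasHeight θ K C (r + r' + 1) (s + s' + 1) (z * z') := by
  obtain ⟨a, ha, ha'⟩ := h
  obtain ⟨b, hb, hb'⟩ := h'
  obtain ⟨t, ht, ht'⟩ := hm
  refine ⟨fun k => ∑ i, ∑ j, a i * b j * t i j k, ?_, fun k => ?_⟩
  · calc (K : ℂ) ^ (r + r' + 1) * (z * z') = K * (((K : ℂ) ^ r * z) * ((K : ℂ) ^ r' * z')) := by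
          ring
      _ = ∑ i, ∑ j, (a i : ℂ) * b j * (K * (θ ^ (i : ℕ) * θ ^ (j : ℕ))) := by
          rw [ha, hb, Finset.sum_mul_sum]
          simp only [Finset.mul_sum]
          exact Finset.sum_congr rfl fun i _ => Finset.sum_congr rfl fun j _ => by ring
      _ = ∑ i, ∑ j, ∑ k, (a i : ℂ) * b j * t i j k * θ ^ (k : ℕ) := by
          simp only [ht, Finset.mul_sum, mul_assoc]
      _ = ∑ k, ∑ i, ∑ j, (a i : ℂ) * b j * t i j k * θ ^ (k : ℕ) := by
          rw [Finset.sum_comm]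
          rw [Finset.sum_congr rfl fun j _ => Finset.sum_comm]
          rw [Finset.sum_comm]
          exact Finset.sum_congr rfl fun k _ => Finset.sum_comm
      _ = _ := by
          push_cast
          simp only [Finset.sum_mul]
  · calc |∑ i, ∑ j, a i * b j * t i j k| ≤ ∑ i, ∑ j, |a i * b j * t i j k| :=
          (Finset.abs_sum_le_sum_abs _ _).trans
            (Finset.sum_le_sum fun i _ => Finset.abs_sum_le_sum_abs _ _)
      _ ≤ ∑ i, ∑ j, (C : ℤ) ^ s * (C : ℤ) ^ s' * |t i j k| := by
          refine Finset.sum_le_sum fun i _ => Finset.sum_le_sum fun j _ => ?_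
          rw [abs_mul, abs_mul]
          gcongr
          · exact ha' i
          · exact hb' j
      _ = (C : ℤ) ^ s * (C : ℤ) ^ s' * ∑ i, ∑ j, |t i j k| := by simp only [Finset.mul_sum]
      _ ≤ (C : ℤ) ^ s * (C : ℤ) ^ s' * C := by
          gcongr
          exact ht' k
      _ = _ := by ring

theorem natDegree_minpoly_pos {θ : ℂ} (hθ : IsAlgebraic ℚ θ) : 0 < (minpoly ℚ θ).natDegree :=
  minpoly.natDegree_pos hθ.isIntegral

theorem HasHeight.one {θ : ℂ} (hθ : IsAlgebraic ℚ θ) (K C : ℕ) : HasHeight θ K C 0 0 1 := by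
  classical
  refine ⟨Pi.single ⟨0, natDegree_minpoly_pos hθ⟩ 1, ?_, fun i => ?_⟩
  · rw [Finset.sum_eq_single ⟨0, natDegree_minpoly_pos hθ⟩] <;> simp +contextual
  · by_cases h : i = ⟨0, natDegree_minpoly_pos hθ⟩
    · subst h; simp
    · simp [h]

/-- Each factor contributes its own exponent `1` and another `1` for the multiplication, hence the
`2`. -/
theorem HasHeight.list_prod {θ : ℂ} (hθ : IsAlgebraic ℚ θ) {K C : ℕ} (hm : MulBound θ K C)
    (l : List ℂ) (h : ∀ z ∈ l, HasHeight θ K C 1 1 z) :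
    HasHeight θ K C (2 * l.length) (2 * l.length) l.prod := by
  induction l with
  | nil => simpa using HasHeight.one hθ K C
  | cons z l ih =>
    have := (h z (by simp)).mul hm (ih fun w hw => h w (by simp [hw]))
    rw [List.prod_cons, List.length_cons]
    convert this using 1 <;> ring

theorem HasHeight.finset_prod {θ : ℂ} (hθ : IsAlgebraic ℚ θ) {K C : ℕ} (hm : MulBound θ K C)
    {ι : Type*} (S : Finset ι) (z : ι → ℂ) (h : ∀ i ∈ S, HasHeight θ K C 1 1 (z i)) :
    HasHeight θ K C (2 * S.card) (2 * S.card) (∏ i ∈ S, z i) := by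
  have := HasHeight.list_prod hθ hm (S.toList.map z) (by simpa using h)
  simpa using this

theorem exists_common_denominator {θ : ℂ} (hθ : IsAlgebraic ℚ θ) {X : Type*} [Fintype X]
    (z : X → ℂ) (hz : ∀ x, z x ∈ IntermediateField.adjoin ℚ {θ}) :
    ∃ (K : ℕ) (a : X → Fin (minpoly ℚ θ).natDegree → ℤ), 0 < K ∧
      ∀ x, (K : ℂ) * z x = ∑ i, (a x i : ℂ) * θ ^ (i : ℕ) := by
  classical
  choose c hc using fun x => exists_coords hθ (hz x)
  let K := ∏ x, ∏ i, (c x i).den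
  have hK : ∀ x i, ∃ b : ℤ, (K : ℚ) * c x i = b := by
    intro x i
    obtain ⟨k, hk⟩ : (c x i).den ∣ K :=
      (Finset.dvd_prod_of_mem (fun i => (c x i).den) (Finset.mem_univ i)).trans
        (Finset.dvd_prod_of_mem (fun x => ∏ i, (c x i).den) (Finset.mem_univ x))
    refine ⟨k * (c x i).num, ?_⟩
    rw [hk]
    push_cast
    have := Rat.mul_den_eq_num (c x i)
    linear_combination (k : ℚ) * this
  choose a ha using hK
  refine ⟨K, a, Finset.prod_pos fun x _ => Finset.prod_pos fun i _ => (c x i).den_pos,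
    fun x => ?_⟩
  rw [hc x, Finset.mul_sum]
  refine Finset.sum_congr rfl fun i _ => ?_
  have : (K : ℂ) * (c x i : ℂ) = a x i := by exact_mod_cast ha x i
  rw [← this]; ring

/-! ### Bit lengths of encoded numbers and answers -/

theorem size_pow_le (K r : ℕ) : (K ^ r).size ≤ r * K.size + 1 := by
  rw [Nat.size_le]
  calc K ^ r ≤ (2 ^ K.size) ^ r := Nat.pow_le_pow_left (Nat.lt_size_self K).le r
    _ = 2 ^ (r * K.size) := by rw [← pow_mul, mul_comm]
    _ < 2 ^ (r * K.size + 1) := Nat.pow_lt_pow_right (by norm_num) (by omega)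

/-- In lowest terms the denominator divides `K ^ r`, and the numerator divides the integer `a`,
which is nonzero unless the numerator is zero. -/
theorem size_encodeRat_le {K r C s : ℕ} (hK : 0 < K) {q : ℚ} {a : ℤ}
    (h : (K : ℚ) ^ r * q = a) (ha : |a| ≤ (C : ℤ) ^ s) :
    (encodeRat q).size ≤ r * K.size + s * C.size + 5 := by
  have h1 : (K : ℤ) ^ r * q.num = a * q.den := by
    have h2 := Rat.mul_den_eq_num q
    have : (K : ℚ) ^ r * q.num = a * q.den := by rw [← h, ← h2]; ring
    exact_mod_cast this
  have hd : (q.den : ℤ) ∣ (K : ℤ) ^ r := by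
    refine (Int.isCoprime_iff_gcd_eq_one.mpr ?_ : IsCoprime (q.den : ℤ) q.num).dvd_of_dvd_mul_right
      ⟨a, by rw [h1, mul_comm]⟩
    have := q.reduced
    rw [Int.gcd_comm]
    simpa [Int.gcd, Nat.Coprime] using this
  obtain ⟨k, hk⟩ := id hd
  have hq : (q.den : ℤ) ≠ 0 := by exact_mod_cast q.den_nz
  have hnum : a = k * q.num := by
    apply mul_right_cancel₀ hq
    rw [← h1, hk]; ring
  have hk0 : k ≠ 0 := by
    rintro rfl
    have : (0 : ℤ) < (K : ℤ) ^ r := by positivity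
    rw [hk] at this; simp at this
  have e1 : q.num.natAbs ≤ C ^ s := by
    have : q.num.natAbs ≤ a.natAbs := by
      rw [hnum, Int.natAbs_mul]
      exact Nat.le_mul_of_pos_left _ (Int.natAbs_pos.mpr hk0)
    refine this.trans ?_
    have h3 : ((a.natAbs : ℕ) : ℤ) ≤ ((C ^ s : ℕ) : ℤ) := by
      rw [Int.natCast_natAbs]; exact_mod_cast ha
    exact_mod_cast h3
  have e2 : q.den ≤ K ^ r :=
    Nat.le_of_dvd (by positivity) (by exact_mod_cast hd)
  have f1 := (Nat.size_le_size e1).trans (size_pow_le C s)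
  have f2 := (Nat.size_le_size e2).trans (size_pow_le K r)
  simp only [encodeRat, Val.size, Int.natAbs_natCast]
  omega

theorem Val.size_ofList (l : List Val) :
    (Val.ofList l).size = (l.map fun v => v.size + 1).sum + 1 := by
  induction l with
  | nil => simp [Val.ofList, Val.size]
  | cons a l ih => simp [Val.ofList, Val.size, ih]; ring

theorem Val.one_le_size (v : Val) : 1 ≤ v.size := by
  cases v <;> simp only [Val.size] <;> omega

theorem List.length_le_sum_map_succ {α : Type*} (f : α → ℕ) (l : List α) :
    l.length ≤ (l.map fun v => f v + 1).sum := by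
  induction l with
  | nil => simp
  | cons a l ih => simp; omega

theorem PinnedDigraph.le_size_encode {m : ℕ} (G : PinnedDigraph m) :
    G.n + G.edges.length ≤ G.encode.size := by
  have h1 := List.length_le_sum_map_succ Val.size (List.ofFn fun v => encodePin (G.pin v))
  have h2 := List.length_le_sum_map_succ Val.size (G.edges.map fun e =>
    .pair (.int ((e.1 : ℕ) : ℤ)) (.int ((e.2 : ℕ) : ℤ)))
  simp only [List.length_ofFn, List.length_map] at h1 h2
  simp only [PinnedDigraph.encode, Val.size, Val.size_ofList]
  omega

theorem size_standardRep_le {θ z : ℂ} {K C r s : ℕ} (hK : 0 < K) (h : HasHeight θ K C r s z)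
    {v : Val} (hv : IsStandardRep θ z v) :
    v.size ≤ (minpoly ℚ θ).natDegree * (r * K.size + s * C.size + 6) + 1 := by
  obtain ⟨a, ha, ha'⟩ := h
  obtain ⟨c, hc, rfl⟩ := hv
  have : (fun i => (K : ℚ) ^ r * c i) = fun i => (a i : ℚ) := by
    apply coords_injective
    push_cast
    rw [← ha, hc, Finset.mul_sum]
    exact Finset.sum_congr rfl fun i _ => by ring
  rw [Val.size_ofList, List.map_ofFn, List.sum_ofFn]
  have : ∑ i, (((fun v : Val => v.size + 1) ∘ fun i => encodeRat (c i)) i) ≤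
      ∑ _i : Fin (minpoly ℚ θ).natDegree, (r * K.size + s * C.size + 6) :=
    Finset.sum_le_sum fun i _ => by
      have := size_encodeRat_le hK (congrFun this i) (ha' i)
      simp only [Function.comp_apply]
      omega
  simpa using this

/-- The standard representation of a partition function has size polynomial (even linear) in the
size of the digraph. -/
theorem exists_size_partitionFunction_le {m : ℕ} {θ : ℂ} {A : Matrix (Fin m) (Fin m) ℂ}
    {D : Matrix (Fin m) (Fin m) ℝ} (h : IsCommonGenerator θ A D) :
    ∃ q : ℕ, ∀ (G : PinnedDigraph m) (v : Val),
      IsStandardRep θ (partitionFunction A (D.map Complex.ofReal) G) v →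
        v.size ≤ q * G.encode.size := by
  classical
  obtain ⟨hθ, hAD⟩ := h
  let d := (minpoly ℚ θ).natDegree
  -- One family for all constants, so that a single denominator serves the entries of both matrices
  -- and the products of powers of `θ`.
  let z : (Fin m × Fin m) ⊕ (Fin m × Fin m) ⊕ (Fin d × Fin d) → ℂ :=
    Sum.elim (fun p => A p.1 p.2) (Sum.elim (fun p => ((D p.1 p.2 : ℝ) : ℂ))
      fun p => θ ^ (p.1 : ℕ) * θ ^ (p.2 : ℕ))
  obtain ⟨K, a, hK, ha⟩ := exists_common_denominator hθ z (by
    rintro (p | p | p)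
    · exact (hAD p.1 p.2).1
    · exact (hAD p.1 p.2).2
    · exact mul_mem (pow_mem (IntermediateField.mem_adjoin_simple_self ℚ θ) _)
        (pow_mem (IntermediateField.mem_adjoin_simple_self ℚ θ) _))
  -- The summand `m` makes the number of configurations at most `C ^ n`; the double sum bounds
  -- single coordinates and sums of structure constants alike.
  let C : ℕ := m + ∑ x, ∑ i, (a x i).natAbs
  have hC : ∀ x i, |a x i| ≤ (C : ℤ) := by
    intro x i
    have h1 : (a x i).natAbs ≤ C :=
      ((Finset.single_le_sum (f := fun i => (a x i).natAbs) (fun _ _ => Nat.zero_le _)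
        (Finset.mem_univ i)).trans (Finset.single_le_sum (f := fun x => ∑ i, (a x i).natAbs)
          (fun _ _ => Nat.zero_le _) (Finset.mem_univ x))).trans (Nat.le_add_left _ _)
    rw [Int.abs_eq_natAbs]
    exact_mod_cast h1
  have hmul : MulBound θ K C := by
    refine ⟨fun i j k => a (.inr (.inr (i, j))) k, fun i j => ha (.inr (.inr (i, j))),
      fun k => ?_⟩
    have h1 : ∑ i : Fin d, ∑ j : Fin d, (a (.inr (.inr (i, j))) k).natAbs ≤ C := by
      rw [← Fintype.sum_prod_type']
      calc ∑ p : Fin d × Fin d, (a (.inr (.inr p)) k).natAbs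
          ≤ ∑ p : Fin d × Fin d, ∑ k, (a (.inr (.inr p)) k).natAbs :=
            Finset.sum_le_sum fun p _ => Finset.single_le_sum
              (f := fun k => (a (.inr (.inr p)) k).natAbs) (fun _ _ => Nat.zero_le _)
              (Finset.mem_univ k)
        _ ≤ C := by
            simp only [C, Fintype.sum_sum_type]
            omega
    simp only [Int.abs_eq_natAbs]
    exact_mod_cast h1
  have hz : ∀ x, HasHeight θ K C 1 1 (z x) := fun x =>
    ⟨a x, by rw [pow_one]; exact ha x, fun i => by rw [pow_one]; exact hC x i⟩
  refine ⟨d * (4 * K.size + 6 * C.size + 6) + 1, fun G v hv => ?_⟩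
  -- Every edge and every free vertex costs `2`, joining the two products costs `1`, and the sum
  -- over configurations costs `G.n` in the second exponent only.
  have hsum : HasHeight θ K C
      (2 * G.edges.length + 2 * (Finset.univ.filter fun v => G.pin v = none).card + 1)
      (2 * G.edges.length + 2 * (Finset.univ.filter fun v => G.pin v = none).card + 1 + G.n)
      (partitionFunction A (D.map Complex.ofReal) G) := by
    refine HasHeight.sum _ _ (fun ξ _ => HasHeight.mul hmul ?_ ?_) _ ?_
    · have := HasHeight.list_prod hθ hmul (G.edges.map fun e => A (ξ e.1) (ξ e.2)) (by
        intro w hw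
        obtain ⟨e, _, rfl⟩ := List.mem_map.mp hw
        exact hz (.inl (ξ e.1, ξ e.2)))
      simpa using this
    · exact HasHeight.finset_prod hθ hmul _ _ fun v _ => hz (.inr (.inl (ξ v, ξ v)))
    · refine (Finset.card_filter_le _ _).trans ?_
      simp only [Finset.card_univ, Fintype.card_fun, Fintype.card_fin]
      exact Nat.pow_le_pow_left (Nat.le_add_right _ _) _
  have h1 := size_standardRep_le hK hsum hv
  have h2 := G.le_size_encode
  have h3 : (Finset.univ.filter fun v => G.pin v = none).card ≤ G.n := by
    simpa using Finset.card_filter_le (Finset.univ : Finset (Fin G.n)) fun v => G.pin v = none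
  have h4 := G.encode.one_le_size
  set p := (Finset.univ.filter fun v => G.pin v = none).card
  set e := G.encode.size
  refine h1.trans ?_
  have h5 : 2 * G.edges.length + 2 * p + 1 ≤ 3 * e := by omega
  have h6 : 2 * G.edges.length + 2 * p + 1 + G.n ≤ 4 * e := by omega
  calc _ ≤ d * (3 * e * K.size + 4 * e * C.size + 6 * e) + 1 * e := by
        gcongr <;> omega
    _ ≤ d * (4 * e * K.size + 6 * e * C.size + 6 * e) + 1 * e := by gcongr <;> norm_num
    _ = _ := by ring


/-! ### Running times of programs -/

/-- With `x` and `y` the absolute values, `x + y < (x + 1) * (y + 1)`, and each factor is at most a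
power of two given by the bit length. -/
theorem size_add_natAbs_le (a b : ℤ) : (a + b).natAbs.size ≤ a.natAbs.size + b.natAbs.size := by
  rw [Nat.size_le, pow_add]
  have h1 := Nat.lt_size_self a.natAbs
  have h2 := Nat.lt_size_self b.natAbs
  have h3 := Int.natAbs_add_le a b
  refine lt_of_lt_of_le ?_ (Nat.mul_le_mul h1 h2)
  generalize a.natAbs = x at *
  generalize b.natAbs = y at *
  refine h3.trans_lt ?_
  simp only [Nat.succ_mul_succ]
  omega

theorem size_mul_natAbs_le (a b : ℤ) : (a * b).natAbs.size ≤ a.natAbs.size + b.natAbs.size := by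
  rw [Nat.size_le, pow_add, Int.natAbs_mul]
  exact Nat.mul_lt_mul'' (Nat.lt_size_self _) (Nat.lt_size_self _)

namespace Val

theorem size_toInt_le (v : Val) : 1 + v.toInt.natAbs.size ≤ v.size := by
  cases v <;> simp [toInt, size, add_assoc]

theorem size_fst_le (v : Val) : v.fst.size ≤ v.size := by
  have := v.one_le_size
  cases v <;> simp_all [fst, size]; omega

theorem size_snd_le (v : Val) : v.snd.size ≤ v.size := by
  have := v.one_le_size
  cases v <;> simp_all [snd, size]

theorem size_ofBool_le (b : Bool) : (ofBool b).size ≤ 2 := by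
  cases b <;> simp [ofBool, size]

end Val

namespace Expr

/-- A bound for the time to evaluate an expression, relative to the sizes of the registers. -/
def weight : Expr → ℕ
  | const z => 1 + (Val.int z).size
  | reg _ => 2
  | fst e => 2 * e.weight + 1
  | snd e => 2 * e.weight + 1
  | isPair e => e.weight + 3
  | pair e f | eq e f | lt e f | add e f | sub e f | mul e f | div e f =>
    2 * e.weight + 2 * f.weight + 3

theorem size_eval_lt_cost (s : State) (e : Expr) : (e.eval s).size < e.cost s := by
  cases e <;> simp only [eval, cost] <;> omega

/-- No operation yields a value longer than its operands together, up to a constant. A fixed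
expression therefore has cost linear in the register bound. -/
theorem cost_le {s : State} {B : ℕ} (h : ∀ x, (s x).size ≤ B) (e : Expr) :
    e.cost s ≤ e.weight * B := by
  have hB : 1 ≤ B := (s 0).one_le_size.trans (h 0)
  induction e with
  | const z => exact Nat.le_mul_of_pos_right _ hB
  | reg x =>
    have := h x
    simp only [cost, weight]; omega
  | fst e ih =>
    have h1 := (e.eval s).size_fst_le
    have h2 := size_eval_lt_cost s e
    simp only [cost, weight, eval]; nlinarith
  | snd e ih =>
    have h1 := (e.eval s).size_snd_le
    have h2 := size_eval_lt_cost s e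
    simp only [cost, weight, eval]; nlinarith
  | isPair e ih =>
    have h1 := Val.size_ofBool_le (e.eval s).isPair
    simp only [cost, weight, eval]; nlinarith
  | pair e f ihe ihf =>
    have h1 := size_eval_lt_cost s e
    have h2 := size_eval_lt_cost s f
    simp only [cost, weight, eval, Val.size]; nlinarith
  | eq e f ihe ihf =>
    have h1 := size_eval_lt_cost s e
    have h2 := size_eval_lt_cost s f
    have h3 := Val.size_ofBool_le (decide (e.eval s = f.eval s))
    simp only [cost, weight, eval]; nlinarith
  | lt e f ihe ihf =>
    have h1 := size_eval_lt_cost s e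
    have h2 := size_eval_lt_cost s f
    have h3 := Val.size_ofBool_le (decide ((e.eval s).toInt < (f.eval s).toInt))
    simp only [cost, weight, eval]; nlinarith
  | add e f ihe ihf =>
    have h1 := size_eval_lt_cost s e
    have h2 := size_eval_lt_cost s f
    have h3 := (e.eval s).size_toInt_le
    have h4 := (f.eval s).size_toInt_le
    have h5 := size_add_natAbs_le (e.eval s).toInt (f.eval s).toInt
    simp only [cost, weight, eval, Val.size]; nlinarith
  | sub e f ihe ihf =>
    have h1 := size_eval_lt_cost s e
    have h2 := size_eval_lt_cost s f
    have h3 := (e.eval s).size_toInt_le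
    have h4 := (f.eval s).size_toInt_le
    have h5 := size_add_natAbs_le (e.eval s).toInt (-(f.eval s).toInt)
    rw [Int.natAbs_neg, ← sub_eq_add_neg] at h5
    simp only [cost, weight, eval, Val.size]; nlinarith
  | mul e f ihe ihf =>
    have h1 := size_eval_lt_cost s e
    have h2 := size_eval_lt_cost s f
    have h3 := (e.eval s).size_toInt_le
    have h4 := (f.eval s).size_toInt_le
    have h5 := size_mul_natAbs_le (e.eval s).toInt (f.eval s).toInt
    simp only [cost, weight, eval, Val.size]; nlinarith
  | div e f ihe ihf =>
    have h1 := size_eval_lt_cost s e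
    have h2 := size_eval_lt_cost s f
    have h3 := (e.eval s).size_toInt_le
    have h5 := Nat.size_le_size (Int.natAbs_ediv_le_natAbs (e.eval s).toInt (f.eval s).toInt)
    simp only [cost, weight, eval, Val.size]; nlinarith

end Expr

/-- The registers that a program may modify. -/
def Program.writes : Program → Finset ℕ
  | skip => ∅
  | assign x _ => {x}
  | seq c d => c.writes ∪ d.writes
  | ite _ c d => c.writes ∪ d.writes
  | .while _ c => c.writes
  | query x _ => {x}

theorem Exec.eq_of_notMem_writes {O : Val → Val} {c : Program} {s s' : State} {t : ℕ}
    (h : Exec O c s s' t) {x : ℕ} (hx : x ∉ c.writes) : s' x = s x := by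
  induction h <;> simp_all [Program.writes]

/-- Writing is charged by length, so a time bound is also a bound on the growth of registers; this
makes polynomial bounds compose. -/
theorem Exec.size_le {O : Val → Val} {c : Program} {s s' : State} {t : ℕ}
    (h : Exec O c s s' t) (x : ℕ) : (s' x).size ≤ (s x).size + t := by
  induction h with
  | assign s y e =>
    have := Expr.size_eval_lt_cost s e
    by_cases hx : x = y
    · subst hx; simp only [Function.update_self]; omega
    · simp [Function.update_of_ne hx]
  | query s y e =>
    by_cases hx : x = y
    · subst hx; simp only [Function.update_self]; omega
    · simp [Function.update_of_ne hx]
  | _ => omega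

/-! ### Hoare rules with polynomial running time -/

/-- For every polynomial bound on the contents of the registers, the program `c` started in a
state that satisfies the precondition `P` halts in polynomial time in a state that satisfies the
postcondition `Q`. The oracle and the size parameter depend on an index. -/
def Realizes {I : Type*} (orc : I → Val → Val) (sz : I → ℕ) (P : I → State → Prop) (c : Program)
    (Q : I → State → Prop) : Prop :=
  ∀ b : Polynomial ℕ, ∃ p : Polynomial ℕ, ∀ i s, P i s → (∀ x, (s x).size ≤ b.eval (sz i)) →
    ∃ s' t, Exec (orc i) c s s' t ∧ t ≤ p.eval (sz i) ∧ Q i s'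

namespace Realizes

variable {I : Type*} {orc : I → Val → Val} {sz : I → ℕ} {P Q R : I → State → Prop}
  {c d : Program}

theorem mono {P' Q' : I → State → Prop} (h : Realizes orc sz P c Q)
    (hP : ∀ i s, P' i s → P i s) (hQ : ∀ i s, Q i s → Q' i s) : Realizes orc sz P' c Q' := by
  intro b
  obtain ⟨p, hp⟩ := h b
  refine ⟨p, fun i s h1 h2 => ?_⟩
  obtain ⟨s', t, h3, h4, h5⟩ := hp i s (hP i s h1) h2
  exact ⟨s', t, h3, h4, hQ i s' h5⟩

theorem skip : Realizes orc sz P .skip P := fun _ =>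
  ⟨1, fun i s h _ => ⟨s, 1, .skip s, by simp, h⟩⟩

theorem assign (x : ℕ) (e : Expr) :
    Realizes orc sz (fun i s => Q i (Function.update s x (e.eval s))) (.assign x e) Q := by
  intro b
  refine ⟨1 + Polynomial.C e.weight * b, fun i s h hb => ⟨_, _, .assign s x e, ?_, h⟩⟩
  simpa using Expr.cost_le hb e

theorem query (x : ℕ) (e : Expr)
    (h : ∀ b : Polynomial ℕ, ∃ q : Polynomial ℕ, ∀ i s, P i s →
      (∀ x, (s x).size ≤ b.eval (sz i)) → (orc i (e.eval s)).size ≤ q.eval (sz i))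
    (hQ : ∀ i s, P i s → Q i (Function.update s x (orc i (e.eval s)))) :
    Realizes orc sz P (.query x e) Q := by
  intro b
  obtain ⟨q, hq⟩ := h b
  refine ⟨1 + Polynomial.C e.weight * b + q, fun i s h hb =>
    ⟨_, _, .query s x e, ?_, hQ i s h⟩⟩
  have h1 := Expr.cost_le hb e
  have h2 := hq i s h hb
  simp only [Polynomial.eval_add, Polynomial.eval_one, Polynomial.eval_mul, Polynomial.eval_C]
  omega

theorem seq (h : Realizes orc sz P c Q) (h' : Realizes orc sz Q d R) :
    Realizes orc sz P (.seq c d) R := by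
  intro b
  obtain ⟨p, hp⟩ := h b
  -- The second program starts from registers that may have grown by the running time of the first.
  obtain ⟨q, hq⟩ := h' (b + p)
  refine ⟨1 + p + q, fun i s h1 h2 => ?_⟩
  obtain ⟨s', t, h3, h4, h5⟩ := hp i s h1 h2
  obtain ⟨s'', t', h6, h7, h8⟩ := hq i s' h5 fun x => by
    have := h3.size_le x
    have := h2 x
    simp only [Polynomial.eval_add]
    omega
  refine ⟨s'', _, .seq h3 h6, ?_, h8⟩
  simp only [Polynomial.eval_add, Polynomial.eval_one]
  omega

theorem ite {e : Expr} (h : Realizes orc sz (fun i s => P i s ∧ e.eval s ≠ .int 0) c Q)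
    (h' : Realizes orc sz (fun i s => P i s ∧ e.eval s = .int 0) d Q) :
    Realizes orc sz P (.ite e c d) Q := by
  intro b
  obtain ⟨p, hp⟩ := h b
  obtain ⟨q, hq⟩ := h' b
  refine ⟨1 + Polynomial.C e.weight * b + p + q, fun i s h1 h2 => ?_⟩
  have h0 := Expr.cost_le h2 e
  simp only [Polynomial.eval_add, Polynomial.eval_one, Polynomial.eval_mul, Polynomial.eval_C]
  by_cases he : e.eval s = .int 0
  · obtain ⟨s', t, h3, h4, h5⟩ := hq i s ⟨h1, he⟩ h2
    exact ⟨s', _, .iteFalse he h3, by omega, h5⟩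
  · obtain ⟨s', t, h3, h4, h5⟩ := hp i s ⟨h1, he⟩ h2
    exact ⟨s', _, .iteTrue he h3, by omega, h5⟩

/-- A condition on registers that are not modified is preserved. -/
theorem frame (h : Realizes orc sz P c Q)
    (hR : ∀ i s s', (∀ x ∉ c.writes, s' x = s x) → R i s → R i s') :
    Realizes orc sz (fun i s => P i s ∧ R i s) c (fun i s => Q i s ∧ R i s) := by
  intro b
  obtain ⟨p, hp⟩ := h b
  refine ⟨p, fun i s h1 h2 => ?_⟩
  obtain ⟨s', t, h3, h4, h5⟩ := hp i s h1.1 h2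
  exact ⟨s', t, h3, h4, h5, hR i s s' (fun x hx => h3.eq_of_notMem_writes hx) h1.2⟩

/-- Auxiliary quantities known only at run time are moved into the index, where time bounds are
uniform. -/
theorem exists_index {α : I → Type*} {P Q : (i : I) → α i → State → Prop}
    (h : Realizes (fun p : (i : I) × α i => orc p.1) (fun p => sz p.1) (fun p => P p.1 p.2) c
      (fun p => Q p.1 p.2)) :
    Realizes orc sz (fun i s => ∃ a, P i a s) c (fun i s => ∃ a, Q i a s) := by
  intro b
  obtain ⟨p, hp⟩ := h b
  refine ⟨p, fun i s ⟨a, h1⟩ h2 => ?_⟩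
  obtain ⟨s', t, h3, h4, h5⟩ := hp ⟨i, a⟩ s h1 h2
  exact ⟨s', t, h3, h4, a, h5⟩

/-- Loops: `Inv` is an invariant, and `μ` decreases with each iteration. -/
theorem while_loop {α : I → Type*} {e : Expr} (Inv : (i : I) → α i → State → Prop)
    (μ : (i : I) → α i → ℕ)
    (hbound : ∀ b : Polynomial ℕ, ∃ q : Polynomial ℕ, ∀ i a s, Inv i a s →
      (∀ x ∉ c.writes, (s x).size ≤ b.eval (sz i)) →
      (∀ x ∈ c.writes, (s x).size ≤ q.eval (sz i)) ∧ μ i a ≤ q.eval (sz i))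
    (hbody : Realizes (fun p : (i : I) × α i => orc p.1) (fun p => sz p.1)
      (fun p s => Inv p.1 p.2 s ∧ e.eval s ≠ .int 0) c
      (fun p s => ∃ a', μ p.1 a' < μ p.1 p.2 ∧ Inv p.1 a' s)) :
    Realizes orc sz (fun i s => ∃ a, Inv i a s) (.while e c)
      (fun i s => ∃ a, Inv i a s ∧ e.eval s = .int 0) := by
  intro b
  -- The invariant itself bounds the written registers at every iteration. Iterating the growth
  -- bound of the body instead would compose polynomials an unbounded number of times.
  obtain ⟨q, hq⟩ := hbound b
  obtain ⟨p, hp⟩ := hbody (b + q)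
  refine ⟨(q + 1) * (1 + Polynomial.C e.weight * (b + q) + p), fun i s ⟨a, ha⟩ hs => ?_⟩
  have key : ∀ n a s, μ i a ≤ n → Inv i a s → (∀ x ∉ c.writes, (s x).size ≤ b.eval (sz i)) →
      ∃ s' t, Exec (orc i) (.while e c) s s' t ∧
        t ≤ (n + 1) * (1 + e.weight * ((b + q).eval (sz i)) + p.eval (sz i)) ∧
        ∃ a, Inv i a s' ∧ e.eval s' = .int 0 := by
    intro n
    induction n with
    | zero =>
      intro a s hn hI hx
      have hB : ∀ x, (s x).size ≤ (b + q).eval (sz i) := by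
        intro x
        rw [Polynomial.eval_add]
        by_cases hw : x ∈ c.writes
        · exact ((hq i a s hI hx).1 x hw).trans (Nat.le_add_left _ _)
        · exact (hx x hw).trans (Nat.le_add_right _ _)
      have hc := Expr.cost_le hB e
      by_cases he : e.eval s = .int 0
      · exact ⟨s, _, .whileFalse he, by omega, a, hI, he⟩
      -- Impossible: another iteration would push the measure below zero.
      · obtain ⟨s', t, -, -, a', h1, -⟩ := hp ⟨i, a⟩ s ⟨hI, he⟩ hB
        simp only at h1
        omega
    | succ n ih =>
      intro a s hn hI hx
      have hB : ∀ x, (s x).size ≤ (b + q).eval (sz i) := by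
        intro x
        rw [Polynomial.eval_add]
        by_cases hw : x ∈ c.writes
        · exact ((hq i a s hI hx).1 x hw).trans (Nat.le_add_left _ _)
        · exact (hx x hw).trans (Nat.le_add_right _ _)
      have hc := Expr.cost_le hB e
      by_cases he : e.eval s = .int 0
      · exact ⟨s, _, .whileFalse he, by nlinarith, a, hI, he⟩
      · obtain ⟨s', t, h1, h2, a', h3, h4⟩ := hp ⟨i, a⟩ s ⟨hI, he⟩ hB
        obtain ⟨s'', t', h5, h6, h7⟩ := ih a' s' (by simp only at h3; omega) h4 fun x hw => by
          rw [h1.eq_of_notMem_writes hw]; exact hx x hw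
        refine ⟨s'', _, .whileTrue he h1 h5, ?_, h7⟩
        simp only at h2
        rw [Nat.succ_mul]
        omega
  obtain ⟨s', t, h1, h2, h3⟩ := key (μ i a) a s le_rfl ha fun x _ => hs x
  refine ⟨s', t, h1, h2.trans ?_, h3⟩
  have := (hq i a s ha fun x _ => hs x).2
  simp only [Polynomial.eval_add, Polynomial.eval_one, Polynomial.eval_mul, Polynomial.eval_C]
  gcongr

end Realizes

/-- The programs `c 0, …, c (n - 1)`, one after the other. -/
def Program.seqRange (c : ℕ → Program) : ℕ → Program
  | 0 => skip
  | n + 1 => seq (seqRange c n) (c n)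

theorem Realizes.seqRange {I : Type*} {orc : I → Val → Val} {sz : I → ℕ} {c : ℕ → Program}
    {P : ℕ → I → State → Prop} (n : ℕ)
    (h : ∀ k < n, Realizes orc sz (P k) (c k) (P (k + 1))) :
    Realizes orc sz (P 0) (Program.seqRange c n) (P n) := by
  induction n with
  | zero => exact Realizes.skip
  | succ n ih => exact (ih fun k hk => h k (by omega)).seq (h n (by omega))


/-! ### Numbering the vertices that are not pinned -/

namespace PinnedDigraph

variable {m : ℕ} (G : PinnedDigraph m)

/-- The number of vertices before the vertex `k` that are not pinned. -/
def freeBefore (k : ℕ) : ℕ := (Finset.univ.filter fun v : Fin G.n => v.val < k ∧ G.pin v = none).card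

theorem freeBefore_zero : G.freeBefore 0 = 0 := by simp [freeBefore]

theorem freeBefore_succ_of_none {v : Fin G.n} (h : G.pin v = none) :
    G.freeBefore (v + 1) = G.freeBefore v + 1 := by
  unfold freeBefore
  rw [← Finset.card_insert_of_notMem (a := v) (by simp)]
  congr 1
  ext w
  simp only [Finset.mem_filter, Finset.mem_univ, true_and, Finset.mem_insert, Fin.ext_iff]
  constructor
  · rintro ⟨h1, h2⟩
    by_cases e : w.val = v.val
    · exact .inl e
    · exact .inr ⟨by omega, h2⟩
  · rintro (h1 | ⟨h1, h2⟩)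
    · exact ⟨by omega, by rw [Fin.ext h1, h]⟩
    · exact ⟨by omega, h2⟩

theorem freeBefore_succ_of_some {v : Fin G.n} {i : Fin m} (h : G.pin v = some i) :
    G.freeBefore (v + 1) = G.freeBefore v := by
  unfold freeBefore
  congr 1
  ext w
  simp only [Finset.mem_filter, Finset.mem_univ, true_and]
  refine ⟨fun ⟨h1, h2⟩ => ⟨?_, h2⟩, fun ⟨h1, h2⟩ => ⟨by omega, h2⟩⟩
  have : w.val ≠ v.val := fun e => by rw [Fin.ext e, h] at h2; cases h2
  omega

theorem freeBefore_mono {k l : ℕ} (h : k ≤ l) : G.freeBefore k ≤ G.freeBefore l :=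
  Finset.card_le_card fun w hw => by
    simp only [Finset.mem_filter, Finset.mem_univ, true_and] at hw ⊢
    exact ⟨by omega, hw.2⟩

theorem freeBefore_n : G.freeBefore G.n = Fintype.card {v : Fin G.n // G.pin v = none} := by
  simp [freeBefore, Fintype.card_subtype]

theorem freeBefore_le (k : ℕ) : G.freeBefore k ≤ G.n := by
  simpa [freeBefore] using Finset.card_filter_le (Finset.univ : Finset (Fin G.n))
    fun v => v.val < k ∧ G.pin v = none

theorem freeBefore_lt {v : Fin G.n} (h : G.pin v = none) :
    G.freeBefore v < G.freeBefore G.n := by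
  have := G.freeBefore_succ_of_none h
  have := G.freeBefore_mono (k := v + 1) (l := G.n) v.2
  omega

/-- The vertices that are not pinned, numbered in their order. -/
noncomputable def freeEquiv :
    {v : Fin G.n // G.pin v = none} ≃ Fin (G.freeBefore G.n) :=
  Equiv.ofBijective (fun v => ⟨G.freeBefore v.1, G.freeBefore_lt v.2⟩) <| by
    rw [Fintype.bijective_iff_injective_and_card]
    refine ⟨fun v w h => ?_, by simp [freeBefore_n]⟩
    have hlt : ∀ v w : {v : Fin G.n // G.pin v = none}, v.1 < w.1 →
        G.freeBefore v.1 < G.freeBefore w.1 := fun v w hvw => by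
      have h1 := G.freeBefore_succ_of_none v.2
      have h2 := G.freeBefore_mono (k := v.1 + 1) (l := w.1) hvw
      omega
    have h' : G.freeBefore v.1 = G.freeBefore w.1 := congrArg Fin.val h
    rcases lt_trichotomy v.1 w.1 with h1 | h1 | h1
    · exact absurd h' (hlt v w h1).ne
    · exact Subtype.ext h1
    · exact absurd h' (hlt w v h1).ne'

/-- The number of a vertex after identifying the vertices pinned to the same index. -/
def newLabel (v : Fin G.n) : ℕ :=
  match G.pin v with
  | none => m + G.freeBefore v
  | some i => i

theorem newLabel_lt (v : Fin G.n) : G.newLabel v < m + G.n + 1 := by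
  unfold newLabel
  have := G.freeBefore_le v
  split
  · omega
  · omega

/-- The part of the encoded list of pinnings that begins with the vertex `k`. -/
def pinsFrom (k : ℕ) : Val := .ofList ((List.ofFn fun v => encodePin (G.pin v)).drop k)

theorem pinsFrom_val (v : Fin G.n) :
    G.pinsFrom v = .pair (encodePin (G.pin v)) (G.pinsFrom (v + 1)) := by
  unfold pinsFrom
  rw [List.drop_eq_getElem_cons (by simp)]
  simp [Val.ofList]

theorem pinsFrom_n : G.pinsFrom G.n = .int 0 := by
  unfold pinsFrom
  rw [List.drop_eq_nil_of_le (by simp)]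
  rfl

end PinnedDigraph

theorem Val.size_ofList_drop_le (l : List Val) (k : ℕ) :
    (Val.ofList (l.drop k)).size ≤ (Val.ofList l).size := by
  induction l generalizing k with
  | nil => simp
  | cons a l ih =>
    cases k with
    | zero => simp
    | succ k =>
      have := ih k
      simp only [List.drop_succ_cons, Val.ofList, Val.size]
      omega

theorem Val.size_natCast_le (n : ℕ) : (Val.int (n : ℤ)).size ≤ 1 + n := by
  simp only [Val.size, Int.natAbs_natCast, add_le_add_iff_left]
  exact Nat.size_le.mpr Nat.lt_two_pow_self

theorem Val.size_ofList_replicate (n : ℕ) :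
    (Val.ofList (List.replicate n (.int 0))).size = 2 * n + 1 := by
  rw [Val.size_ofList]
  simp [Val.size, mul_comm]

theorem PinnedDigraph.size_pinsFrom_le {m : ℕ} (G : PinnedDigraph m) (k : ℕ) :
    (G.pinsFrom k).size ≤ G.encode.size := by
  refine (Val.size_ofList_drop_le _ k).trans ?_
  simp only [encode, Val.size]
  omega

/-! ### Programs on digraphs -/

section Programs

/-- Writes the list of the vertices that are not pinned, with its length, to register `1`. -/
def scanProgram : Program :=
  .seq (.assign 1 (.pair (.fst (.reg 0)) (.pair (.const 0) (.const 0))))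
    (.while (.isPair (.fst (.reg 1)))
      (.ite (.fst (.fst (.reg 1)))
        (.assign 1 (.pair (.snd (.fst (.reg 1))) (.snd (.reg 1))))
        (.assign 1 (.pair (.snd (.fst (.reg 1)))
          (.pair (.add (.fst (.snd (.reg 1))) (.const 1))
            (.pair (.const 0) (.snd (.snd (.reg 1)))))))))

/-- The contents of register `1` after `k` vertices. -/
def PinnedDigraph.scanned {m : ℕ} (G : PinnedDigraph m) (k : ℕ) : Val :=
  .pair (G.pinsFrom k) (.pair (.int (G.freeBefore k))
    (.ofList (List.replicate (G.freeBefore k) (.int 0))))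

variable {I : Type*} {orc : I → Val → Val} {sz : I → ℕ} {m : ℕ}

/-- The invariant's auxiliary index `k` counts the vertices read. Since pinned indices are encoded
from `1`, the integer `0` recognizes a free vertex. -/
theorem realizes_scanProgram (G : I → PinnedDigraph m) :
    Realizes orc sz (fun i s => s 0 = (G i).encode) scanProgram
      (fun i s => s 0 = (G i).encode ∧ s 1 = (G i).scanned (G i).n) := by
  have hloop := Realizes.while_loop (orc := orc) (sz := sz) (α := fun _ => ℕ)
    (e := .isPair (.fst (.reg 1)))
    (c := .ite (.fst (.fst (.reg 1)))
        (.assign 1 (.pair (.snd (.fst (.reg 1))) (.snd (.reg 1))))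
        (.assign 1 (.pair (.snd (.fst (.reg 1)))
          (.pair (.add (.fst (.snd (.reg 1))) (.const 1))
            (.pair (.const 0) (.snd (.snd (.reg 1))))))))
    (fun i k s => s 0 = (G i).encode ∧ k ≤ (G i).n ∧ s 1 = (G i).scanned k)
    (fun i k => (G i).n - k) ?_ ?_
  · refine Realizes.seq ((Realizes.assign _ _).mono ?_ fun _ _ h => h) (hloop.mono
      (fun i s h => ⟨0, h⟩) ?_)
    · intro i s h
      simp [Expr.eval, h, PinnedDigraph.scanned, PinnedDigraph.freeBefore_zero, Val.ofList,
        PinnedDigraph.encode, PinnedDigraph.pinsFrom, Val.fst]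
    · rintro i s ⟨k, ⟨h0, hk, h1⟩, he⟩
      refine ⟨h0, ?_⟩
      rcases hk.lt_or_eq with hk | hk
      · have := (G i).pinsFrom_val ⟨k, hk⟩
        simp only at this
        simp [Expr.eval, h1, PinnedDigraph.scanned, Val.fst, this, Val.isPair, Val.ofBool] at he
      · rw [h1, hk]
  · intro b
    refine ⟨Polynomial.C 10 * b, ?_⟩
    rintro i k s ⟨h0, hk, h1⟩ hb
    have hB := hb 0 (by simp [Program.writes])
    rw [h0] at hB
    have e1 := (G i).le_size_encode
    have e2 := (G i).size_pinsFrom_le k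
    have e3 := (G i).freeBefore_le k
    have e4 := Val.size_natCast_le ((G i).freeBefore k)
    have e5 := (G i).encode.one_le_size
    simp only [Polynomial.eval_mul, Polynomial.eval_C]
    refine ⟨fun x hx => ?_, by omega⟩
    obtain rfl : x = 1 := by simpa [Program.writes] using hx
    rw [h1]
    simp only [PinnedDigraph.scanned, Val.size, Val.size_ofList_replicate] at e4 ⊢
    omega
  · have step : ∀ (i : I) (k : ℕ) (s : State), (s 0 = (G i).encode ∧ k ≤ (G i).n ∧
        s 1 = (G i).scanned k) → (Expr.isPair (.fst (.reg 1))).eval s ≠ .int 0 →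
        ∃ v : Fin (G i).n, v.val = k := by
      rintro i k s ⟨-, hk, h1⟩ he
      refine ⟨⟨k, lt_of_le_of_ne hk ?_⟩, rfl⟩
      rintro rfl
      simp [Expr.eval, h1, PinnedDigraph.scanned, Val.fst, PinnedDigraph.pinsFrom_n, Val.isPair,
        Val.ofBool] at he
    refine Realizes.ite ((Realizes.assign _ _).mono ?_ fun _ _ h => h)
      ((Realizes.assign _ _).mono ?_ fun _ _ h => h)
    · rintro ⟨i, k⟩ s ⟨⟨hI, he⟩, hc⟩
      obtain ⟨v, rfl⟩ := step i k s hI he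
      obtain ⟨h0, -, h1⟩ := hI
      simp only at h0 h1
      refine ⟨v + 1, by have := v.2; simp only; omega, by simpa using h0, v.2, ?_⟩
      simp only [Expr.eval, h1, PinnedDigraph.scanned, Val.fst, (G i).pinsFrom_val] at hc
      cases h : (G i).pin v with
      | none => simp [h, encodePin] at hc
      | some j =>
        simp [Expr.eval, h1, PinnedDigraph.scanned, Val.fst, Val.snd, (G i).pinsFrom_val,
          (G i).freeBefore_succ_of_some h]
    · rintro ⟨i, k⟩ s ⟨⟨hI, he⟩, hc⟩
      obtain ⟨v, rfl⟩ := step i k s hI he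
      obtain ⟨h0, -, h1⟩ := hI
      simp only at h0 h1
      refine ⟨v + 1, by have := v.2; simp only; omega, by simpa using h0, v.2, ?_⟩
      simp only [Expr.eval, h1, PinnedDigraph.scanned, Val.fst, (G i).pinsFrom_val] at hc
      cases h : (G i).pin v with
      | none =>
        simp [Expr.eval, h1, PinnedDigraph.scanned, Val.fst, Val.snd, (G i).pinsFrom_val,
          (G i).freeBefore_succ_of_none h, Val.toInt, List.replicate_succ, Val.ofList]
      | some j =>
        simp only [h, encodePin, Val.int.injEq] at hc
        omega

/-- Walks through the list of pinnings to the vertex `u`, counting the vertices that are not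
pinned; works on register `x`. -/
def lookupProgram (x : ℕ) (u : Expr) : Program :=
  .seq (.assign x (.pair u (.pair (.const 0) (.fst (.reg 0)))))
    (.while (.fst (.reg x))
      (.assign x (.pair (.sub (.fst (.reg x)) (.const 1))
        (.pair (.add (.fst (.snd (.reg x))) (.eq (.fst (.snd (.snd (.reg x)))) (.const 0)))
          (.snd (.snd (.snd (.reg x))))))))

/-- The contents of the register after the lookup of `v`. -/
def PinnedDigraph.found {m : ℕ} (G : PinnedDigraph m) (v : Fin G.n) : Val :=
  .pair (.int 0) (.pair (.int (G.freeBefore v)) (G.pinsFrom v))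

theorem realizes_lookupProgram (G : I → PinnedDigraph m) (v : (i : I) → Fin (G i).n) (x : ℕ)
    (hx : x ≠ 0) (u : Expr) :
    Realizes orc sz (fun i s => s 0 = (G i).encode ∧ u.eval s = .int ((v i : ℕ) : ℤ))
      (lookupProgram x u) (fun i s => s x = (G i).found (v i)) := by
  have hloop := Realizes.while_loop (orc := orc) (sz := sz) (α := fun _ => ℕ)
    (e := .fst (.reg x))
    (c := .assign x (.pair (.sub (.fst (.reg x)) (.const 1))
        (.pair (.add (.fst (.snd (.reg x))) (.eq (.fst (.snd (.snd (.reg x)))) (.const 0)))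
          (.snd (.snd (.snd (.reg x)))))))
    -- The first component counts down the steps left to reach the vertex; its vanishing ends the
    -- loop.
    (fun i k s => s 0 = (G i).encode ∧ k ≤ v i ∧ s x = .pair (.int ((v i : ℕ) - (k : ℕ) : ℤ))
      (.pair (.int ((G i).freeBefore k)) ((G i).pinsFrom k)))
    (fun i k => v i - k) ?_ ?_
  · refine Realizes.seq ((Realizes.assign _ _).mono ?_ fun _ _ h => h) (hloop.mono
      (fun i s h => ⟨0, h⟩) ?_)
    · rintro i s ⟨h0, hu⟩
      simp [Expr.eval, h0, hu, PinnedDigraph.freeBefore_zero, hx.symm,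
        PinnedDigraph.encode, PinnedDigraph.pinsFrom, Val.fst]
    · rintro i s ⟨k, ⟨h0, hk, h1⟩, he⟩
      simp only [Expr.eval, h1, Val.fst, Val.int.injEq] at he
      obtain rfl : k = v i := by omega
      simpa [PinnedDigraph.found] using h1
  · intro b
    refine ⟨Polynomial.C 10 * b, ?_⟩
    rintro i k s ⟨h0, hk, h1⟩ hb
    have hB := hb 0 (by simp [Program.writes, hx.symm])
    rw [h0] at hB
    have e1 := (G i).le_size_encode
    have e2 := (G i).size_pinsFrom_le k
    have e3 := (G i).freeBefore_le k
    have e4 := Val.size_natCast_le ((G i).freeBefore k)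
    have e5 := (G i).encode.one_le_size
    have e6 := Val.size_natCast_le (v i - k)
    have e7 := (v i).2
    rw [Nat.cast_sub hk] at e6
    simp only [Polynomial.eval_mul, Polynomial.eval_C]
    refine ⟨fun y hy => ?_, by omega⟩
    obtain rfl : y = x := by simpa [Program.writes] using hy
    rw [h1]
    simp only [Val.size] at e4 e6 ⊢
    omega
  · refine (Realizes.assign _ _).mono ?_ fun _ _ h => h
    rintro ⟨i, k⟩ s ⟨⟨h0, hk, h1⟩, he⟩
    simp only at h0 h1 hk
    have hk' : k < v i := by
      refine lt_of_le_of_ne hk ?_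
      rintro rfl
      simp [Expr.eval, h1, Val.fst] at he
    have hkn : k < (G i).n := hk'.trans (v i).2
    have e1 := (G i).pinsFrom_val ⟨k, hkn⟩
    simp only at e1
    refine ⟨k + 1, by simp only; omega, by simpa [hx.symm] using h0, hk', ?_⟩
    cases h : (G i).pin ⟨k, hkn⟩ with
    | none =>
      have e2 := (G i).freeBefore_succ_of_none h
      simp only at e2
      simp [Expr.eval, h1, Val.fst, Val.snd, e1, h, e2, Val.toInt, encodePin, Val.ofBool]
      omega
    | some j =>
      have e2 := (G i).freeBefore_succ_of_some h
      have : ((j : ℕ) : ℤ) + 1 ≠ 0 := by omega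
      simp only at e2
      simp [Expr.eval, h1, Val.fst, Val.snd, e1, h, e2, Val.toInt, encodePin, Val.ofBool, this]
      omega

/-- The new number of a vertex after its lookup in register `x`. -/
def labelExpr (m x : ℕ) : Expr :=
  .add (.mul (.eq (.fst (.snd (.snd (.reg x)))) (.const 0))
      (.add (.const m) (.fst (.snd (.reg x)))))
    (.mul (.sub (.const 1) (.eq (.fst (.snd (.snd (.reg x)))) (.const 0)))
      (.sub (.fst (.snd (.snd (.reg x)))) (.const 1)))

/-- The value `0` or `1` of the equality test selects a summand in place of a branch; subtracting
`1` undoes the shift in `encodePin`. -/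
theorem eval_labelExpr (G : PinnedDigraph m) (v : Fin G.n) {s : State} {x : ℕ}
    (h : s x = G.found v) : (labelExpr m x).eval s = .int (G.newLabel v) := by
  unfold PinnedDigraph.newLabel
  cases hv : G.pin v with
  | none =>
    simp [labelExpr, Expr.eval, h, PinnedDigraph.found, Val.fst, Val.snd, G.pinsFrom_val, hv,
      encodePin, Val.ofBool, Val.toInt]
  | some j =>
    have : ((j : ℕ) : ℤ) + 1 ≠ 0 := by omega
    simp [labelExpr, Expr.eval, h, PinnedDigraph.found, Val.fst, Val.snd, G.pinsFrom_val, hv,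
      encodePin, Val.ofBool, Val.toInt, this]

/-- Writes the list of edges, with the vertices renumbered, to register `2`. -/
def edgesProgram (m : ℕ) : Program :=
  .seq (.assign 2 (.pair (.snd (.reg 0)) (.const 0)))
    (.while (.isPair (.fst (.reg 2)))
      (.seq (lookupProgram 3 (.fst (.fst (.fst (.reg 2)))))
        (.seq (lookupProgram 4 (.snd (.fst (.fst (.reg 2)))))
          (.seq (.assign 2 (.pair (.snd (.fst (.reg 2)))
              (.pair (.pair (labelExpr m 3) (labelExpr m 4)) (.snd (.reg 2)))))
            -- Clearing the work registers lets the loop invariant bound their size.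
            (.seq (.assign 3 (.const 0)) (.assign 4 (.const 0)))))))

def encodeEdge {n : ℕ} (e : Fin n × Fin n) : Val :=
  .pair (.int ((e.1 : ℕ) : ℤ)) (.int ((e.2 : ℕ) : ℤ))

def PinnedDigraph.newEdge (G : PinnedDigraph m) (e : Fin G.n × Fin G.n) : Val :=
  .pair (.int (G.newLabel e.1)) (.int (G.newLabel e.2))

theorem PinnedDigraph.encode_eq (G : PinnedDigraph m) :
    G.encode = .pair (G.pinsFrom 0) (.ofList (G.edges.map encodeEdge)) := rfl

theorem Val.size_ofList_le {l : List Val} {B : ℕ} (h : ∀ v ∈ l, v.size ≤ B) :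
    (Val.ofList l).size ≤ l.length * (B + 1) + 1 := by
  induction l with
  | nil => simp [Val.ofList, Val.size]
  | cons a l ih =>
    have h1 := h a (by simp)
    have h2 := ih fun v hv => h v (by simp [hv])
    simp only [Val.ofList, Val.size, List.length_cons, Nat.succ_mul]
    omega

/-- The edges that are already renumbered, and those that are not. -/
abbrev EdgeSplit (n : ℕ) : Type := List (Fin n × Fin n) × List (Fin n × Fin n)

/-- The next edge, and the edges after it. -/
abbrev EdgeCons (n : ℕ) : Type := (Fin n × Fin n) × List (Fin n × Fin n)

theorem realizes_edgesProgram (G : I → PinnedDigraph m) :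
    Realizes orc sz (fun i s => s 0 = (G i).encode ∧ s 3 = .int 0 ∧ s 4 = .int 0)
      (edgesProgram m)
      (fun i s => s 2 = .pair (.int 0) (.ofList ((G i).edges.reverse.map (G i).newEdge))) := by
  -- The finished edges are stored in reverse, hence `a.1.reverse ++ a.2`.
  let Inv : (i : I) → EdgeSplit (G i).n → State → Prop := fun i a s =>
    s 0 = (G i).encode ∧ s 3 = .int 0 ∧ s 4 = .int 0 ∧ a.1.reverse ++ a.2 = (G i).edges ∧
      s 2 = .pair (.ofList (a.2.map encodeEdge)) (.ofList (a.1.map (G i).newEdge))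
  have hloop := Realizes.while_loop (orc := orc) (sz := sz) (α := fun i => EdgeSplit (G i).n)
    (e := .isPair (.fst (.reg 2)))
    (c := .seq (lookupProgram 3 (.fst (.fst (.fst (.reg 2)))))
        (.seq (lookupProgram 4 (.snd (.fst (.fst (.reg 2)))))
          (.seq (.assign 2 (.pair (.snd (.fst (.reg 2)))
              (.pair (.pair (labelExpr m 3) (labelExpr m 4)) (.snd (.reg 2)))))
            (.seq (.assign 3 (.const 0)) (.assign 4 (.const 0))))))
    Inv (fun i a => a.2.length) ?_ ?_
  · refine Realizes.seq ((Realizes.assign _ _).mono ?_ fun _ _ h => h) (hloop.mono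
      (fun i s h => ⟨([], (G i).edges), h⟩) ?_)
    · rintro i s ⟨h0, h3, h4⟩
      simp [Inv, Expr.eval, h0, h3, h4, PinnedDigraph.encode_eq, Val.ofList, Val.snd]
    · rintro i s ⟨⟨l1, l2⟩, ⟨-, -, -, hl, h2⟩, he⟩
      simp only at hl h2
      cases l2 with
      | nil =>
        rw [h2, ← hl]
        simp [Val.ofList]
      | cons e l2 =>
        simp [Expr.eval, h2, Val.ofList, Val.fst, Val.isPair, Val.ofBool] at he
  · intro b
    refine ⟨b * (Polynomial.C (2 * m + 20) * b) + b + 4, ?_⟩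
    rintro i ⟨l1, l2⟩ s ⟨h0, h3, h4, hl, h2⟩ hb
    have hB := hb 0 (by simp [Program.writes, lookupProgram])
    rw [h0] at hB
    simp only at hl h2
    have e1 := (G i).le_size_encode
    have e5 := (G i).encode.one_le_size
    have e2 : (Val.ofList (l2.map encodeEdge)).size ≤ (G i).encode.size := by
      have : l2.map encodeEdge = ((G i).edges.map encodeEdge).drop l1.length := by
        rw [← hl, List.map_append, List.drop_append_of_le_length (by simp),
          List.drop_eq_nil_of_le (by simp), List.nil_append]
      rw [this]
      refine (Val.size_ofList_drop_le _ _).trans ?_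
      simp only [PinnedDigraph.encode_eq, Val.size]
      omega
    have hlen : l1.length + l2.length = (G i).edges.length := by rw [← hl]; simp
    have e3 := Val.size_ofList_le (l := l1.map (G i).newEdge) (B := 2 * (m + (G i).n + 2) + 1) (by
      intro w hw
      obtain ⟨e, -, rfl⟩ := List.mem_map.mp hw
      have f1 := (G i).newLabel_lt e.1
      have f2 := (G i).newLabel_lt e.2
      have f3 := Val.size_natCast_le ((G i).newLabel e.1)
      have f4 := Val.size_natCast_le ((G i).newLabel e.2)
      simp only [PinnedDigraph.newEdge]
      rw [Val.size]
      omega)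
    rw [List.length_map] at e3
    have e4 : l1.length * (2 * (m + (G i).n + 2) + 1 + 1) ≤
        b.eval (sz i) * ((2 * m + 20) * b.eval (sz i)) := by
      apply Nat.mul_le_mul
      · omega
      · nlinarith
    simp only [Polynomial.eval_mul, Polynomial.eval_C, Polynomial.eval_add, Polynomial.eval_ofNat]
    refine ⟨fun y hy => ?_, by omega⟩
    have hy : y = 3 ∨ y = 4 ∨ y = 2 := by
      simp [Program.writes, lookupProgram] at hy; tauto
    rcases hy with rfl | rfl | rfl
    · rw [h3]; simp only [Val.size, Int.natAbs_zero, Nat.size_zero]; omega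
    · rw [h4]; simp only [Val.size, Int.natAbs_zero, Nat.size_zero]; omega
    · rw [h2, Val.size]; omega
  -- The next edge becomes part of the index, so that both lookups have a target vertex determined
  -- by the index.
  · let Pre : (p : (i : I) × EdgeSplit (G i).n) → EdgeCons (G p.1).n → State → Prop := fun p a s =>
      p.2.2 = a.1 :: a.2 ∧ Inv p.1 p.2 s
    have hb : Realizes (fun p : (i : I) × EdgeSplit (G i).n => orc p.1) (fun p => sz p.1)
        (fun p s => ∃ a : EdgeCons (G p.1).n, Pre p a s)
        (.seq (lookupProgram 3 (.fst (.fst (.fst (.reg 2)))))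
        (.seq (lookupProgram 4 (.snd (.fst (.fst (.reg 2)))))
          (.seq (.assign 2 (.pair (.snd (.fst (.reg 2)))
              (.pair (.pair (labelExpr m 3) (labelExpr m 4)) (.snd (.reg 2)))))
            (.seq (.assign 3 (.const 0)) (.assign 4 (.const 0))))))
        (fun p s => ∃ a : EdgeCons (G p.1).n, p.2.2 = a.1 :: a.2 ∧ Inv p.1 (a.1 :: p.2.1, a.2) s) := by
      refine Realizes.exists_index ?_
      have l3 := realizes_lookupProgram
        (orc := fun p : (p : (i : I) × EdgeSplit (G i).n) × EdgeCons (G p.1).n => orc p.1.1) (sz := fun p => sz p.1.1)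
        (fun p => G p.1.1) (fun p => p.2.1.1) 3 (by norm_num) (.fst (.fst (.fst (.reg 2))))
      have l4 := realizes_lookupProgram
        (orc := fun p : (p : (i : I) × EdgeSplit (G i).n) × EdgeCons (G p.1).n => orc p.1.1) (sz := fun p => sz p.1.1)
        (fun p => G p.1.1) (fun p => p.2.1.2) 4 (by norm_num) (.snd (.fst (.fst (.reg 2))))
      have l3' := l3.frame (R := fun p s => p.1.2.2 = p.2.1 :: p.2.2 ∧
          p.1.2.1.reverse ++ p.1.2.2 = (G p.1.1).edges ∧ s 0 = (G p.1.1).encode ∧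
          s 2 = .pair (.ofList (p.1.2.2.map encodeEdge))
            (.ofList (p.1.2.1.map (G p.1.1).newEdge))) (by
        rintro p s s' hs ⟨h1, h2, h3, h4⟩
        refine ⟨h1, h2, ?_, ?_⟩
        · rw [hs 0 (by simp [Program.writes, lookupProgram])]; exact h3
        · rw [hs 2 (by simp [Program.writes, lookupProgram])]; exact h4)
      have l4' := l4.frame (R := fun p s => s 3 = (G p.1.1).found p.2.1.1 ∧
          p.1.2.2 = p.2.1 :: p.2.2 ∧
          p.1.2.1.reverse ++ p.1.2.2 = (G p.1.1).edges ∧ s 0 = (G p.1.1).encode ∧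
          s 2 = .pair (.ofList (p.1.2.2.map encodeEdge))
            (.ofList (p.1.2.1.map (G p.1.1).newEdge))) (by
        rintro p s s' hs ⟨h0, h1, h2, h3, h4⟩
        refine ⟨?_, h1, h2, ?_, ?_⟩
        · rw [hs 3 (by simp [Program.writes, lookupProgram])]; exact h0
        · rw [hs 0 (by simp [Program.writes, lookupProgram])]; exact h3
        · rw [hs 2 (by simp [Program.writes, lookupProgram])]; exact h4)
      refine Realizes.seq (l3'.mono ?_ fun _ _ h => h) (Realizes.seq (l4'.mono ?_ fun _ _ h => h)
        (Realizes.seq ((Realizes.assign _ _).mono ?_ fun _ _ h => h)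
          (Realizes.seq (Realizes.assign _ _) (Realizes.assign _ _))))
      · rintro p s ⟨he, h0, -, -, hl, h2⟩
        exact ⟨⟨h0, by simp [Expr.eval, h2, he, Val.ofList, Val.fst, encodeEdge]⟩, he, hl, h0, h2⟩
      · rintro p s ⟨h3, he, hl, h0, h2⟩
        exact ⟨⟨h0, by simp [Expr.eval, h2, he, Val.ofList, Val.fst, Val.snd, encodeEdge]⟩,
          h3, he, hl, h0, h2⟩
      · rintro p s ⟨h4, h3, he, hl, h0, h2⟩
        refine ⟨he, ?_⟩
        rw [he] at hl
        simp [Inv, h0, hl, Expr.eval, eval_labelExpr _ _ h3, eval_labelExpr _ _ h4, h2, he,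
          Val.ofList, Val.fst, Val.snd, PinnedDigraph.newEdge]
    refine hb.mono ?_ ?_
    · rintro p s ⟨hI, he⟩
      rcases h : p.2.2 with _ | ⟨e, l⟩
      · have h2 := hI.2.2.2.2
        simp [Expr.eval, h2, h, Val.ofList, Val.fst, Val.isPair, Val.ofBool] at he
      · exact ⟨(e, l), h, hI⟩
    · rintro p s ⟨a, h, hI⟩
      exact ⟨_, by simp [h], hI⟩

end Programs


/-! ### Queries -/

section Queries

variable {m : ℕ}

/-- The numbering of the vertices of the union of a digraph with a labelled graph. -/
noncomputable def PinnedDigraph.vertexEquiv (G : PinnedDigraph m) (h : ℕ) :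
    Fin m ⊕ ({v : Fin G.n // G.pin v = none} ⊕ Fin h) ≃ Fin (m + (G.freeBefore G.n + h)) :=
  (Equiv.sumCongr (Equiv.refl _)
    ((Equiv.sumCongr G.freeEquiv (Equiv.refl _)).trans finSumFinEquiv)).trans finSumFinEquiv

/-- The union of a digraph, with its pinned vertices identified with the labelled vertices, with a
labelled graph, as a digraph without pinning. -/
noncomputable def PinnedDigraph.extend (G : PinnedDigraph m)
    (H : Σ h : ℕ, List ((Fin m ⊕ Fin h) × (Fin m ⊕ Fin h))) : PinnedDigraph m :=
  unpinned (G.vertexEquiv H.1) (glue G.labelledEdges.reverse H.2)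

/-- Links the number computed by the program to the bijection that defines the glued graph: labels
first, then free vertices, then those of the fixed graph. -/
theorem PinnedDigraph.vertexEquiv_label (G : PinnedDigraph m) (h : ℕ) (v : Fin G.n) :
    (G.vertexEquiv h (Sum.map id Sum.inl (G.label v))).val = G.newLabel v := by
  unfold newLabel
  cases hv : G.pin v with
  | none => simp [G.label_of_none hv, vertexEquiv, freeEquiv]
  | some i => simp [G.label_of_some hv, vertexEquiv]

/-- A list that begins with given expressions. -/
def consExpr (l : List Expr) (e : Expr) : Expr := l.foldr .pair e

theorem eval_consExpr {s : State} {e : Expr} {r : List Val} (h : e.eval s = .ofList r)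
    (l : List Expr) : (consExpr l e).eval s = .ofList (l.map (Expr.eval s) ++ r) := by
  induction l with
  | nil => simpa [consExpr] using h
  | cons a l ih =>
    simp only [consExpr, List.foldr_cons, Expr.eval, List.map_cons, List.cons_append, Val.ofList]
    rw [← ih]; rfl

/-- The number of a vertex of the constant labelled graph in the union. -/
def vertexExpr (m : ℕ) {h : ℕ} : Fin m ⊕ Fin h → Expr
  | .inl i => .const i
  | .inr w => .add (.fst (.snd (.reg 1))) (.const (m + w))

/-- The encoding of the union with a constant labelled graph. -/
def queryExpr (m : ℕ) (H : Σ h : ℕ, List ((Fin m ⊕ Fin h) × (Fin m ⊕ Fin h))) : Expr :=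
  .pair (consExpr (List.replicate (m + H.1) (.const 0)) (.snd (.snd (.reg 1))))
    (consExpr (H.2.map fun e => .pair (vertexExpr m e.1) (vertexExpr m e.2)) (.snd (.reg 2)))

theorem eval_vertexExpr (G : PinnedDigraph m) {s : State} (h1 : s 1 = G.scanned G.n) {h : ℕ}
    (x : Fin m ⊕ Fin h) :
    (vertexExpr m x).eval s = .int (G.vertexEquiv h (Sum.map id Sum.inr x)).val := by
  rcases x with i | w
  · simp [vertexExpr, Expr.eval, PinnedDigraph.vertexEquiv]
  · simp [vertexExpr, Expr.eval, PinnedDigraph.vertexEquiv, h1, PinnedDigraph.scanned, Val.fst,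
      Val.snd, Val.toInt]
    ring

/-- The fixed graph's edges are put in front, as in `glue`. The vertex lists agree as soon as their
lengths do, since no vertex is pinned. -/
theorem eval_queryExpr (G : PinnedDigraph m)
    (H : Σ h : ℕ, List ((Fin m ⊕ Fin h) × (Fin m ⊕ Fin h))) {s : State}
    (h1 : s 1 = G.scanned G.n)
    (h2 : s 2 = .pair (.int 0) (.ofList (G.edges.reverse.map G.newEdge))) :
    (queryExpr m H).eval s = (G.extend H).encode := by
  have e1 := eval_consExpr (s := s) (e := .snd (.snd (.reg 1)))
    (r := List.replicate (G.freeBefore G.n) (.int 0))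
    (by simp [Expr.eval, h1, PinnedDigraph.scanned, Val.snd])
    (List.replicate (m + H.1) (.const 0))
  have e2 := eval_consExpr (s := s) (e := .snd (.reg 2)) (r := G.edges.reverse.map G.newEdge)
    (by simp [Expr.eval, h2, Val.snd])
    (H.2.map fun e => .pair (vertexExpr m e.1) (vertexExpr m e.2))
  rw [queryExpr, Expr.eval, e1, e2]
  simp only [PinnedDigraph.encode, PinnedDigraph.extend, unpinned, encodePin]
  congr 2
  · simp only [List.map_replicate, Expr.eval, List.replicate_append_replicate, List.ofFn_const]
    congr 1
    ring
  · simp only [glue, List.map_append, List.map_map, PinnedDigraph.labelledEdges,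
      ← List.map_reverse]
    congr 1
    · refine List.map_congr_left fun e _ => ?_
      simp [Expr.eval, eval_vertexExpr G h1]
    · refine List.map_congr_left fun e _ => ?_
      simp [PinnedDigraph.newEdge, G.vertexEquiv_label]

theorem partitionFunction_extend (A D : Matrix (Fin m) (Fin m) ℂ) (G : PinnedDigraph m)
    (H : Σ h : ℕ, List ((Fin m ⊕ Fin h) × (Fin m ⊕ Fin h))) :
    partitionFunction A D (G.extend H) =
      ∑ ψ : Fin m → Fin m, (∏ i, D (ψ i) (ψ i)) *
        labelledSum A D (glue G.labelledEdges H.2) ψ := by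
  rw [PinnedDigraph.extend, partitionFunction_unpinned]
  simp only [labelledSum_glue, labelledSum_reverse]

end Queries

/-! ### Rational arithmetic -/

/-- The `k`-th entry of a list. -/
def nthExpr : ℕ → Expr → Expr
  | 0, e => .fst e
  | k + 1, e => nthExpr k (.snd e)

theorem eval_nthExpr {s : State} {e : Expr} {l : List Val} (h : e.eval s = .ofList l) {k : ℕ}
    (hk : k < l.length) : (nthExpr k e).eval s = l[k] := by
  induction k generalizing e l with
  | zero =>
    cases l with
    | nil => simp at hk
    | cons a l => simp [nthExpr, Expr.eval, h, Val.ofList, Val.fst]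
  | succ k ih =>
    cases l with
    | nil => simp at hk
    | cons a l =>
      simp only [nthExpr, List.getElem_cons_succ]
      exact ih (by simp [Expr.eval, h, Val.ofList, Val.snd]) _

/-- Numerator and denominator, not reduced, of a linear combination of rational numbers. -/
def linCombExpr {ι : Type*} (q : ι → ℚ) (x : ι → Expr) : List ι → Expr × Expr
  | [] => (.const 0, .const 1)
  | i :: l =>
    let r := linCombExpr q x l
    (.add (.mul r.1 (.mul (.const (q i).den) (.snd (x i))))
        (.mul r.2 (.mul (.const (q i).num) (.fst (x i)))),
      .mul r.2 (.mul (.const (q i).den) (.snd (x i))))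

/-- The number of terms is constant, so common factors may accumulate here without harm; only the
final fraction must be reduced. -/
theorem eval_linCombExpr {ι : Type*} (q : ι → ℚ) (x : ι → Expr) (r : ι → ℚ) {s : State}
    (l : List ι) (h : ∀ i ∈ l, (x i).eval s = encodeRat (r i)) :
    ∃ a b : ℤ, (linCombExpr q x l).1.eval s = .int a ∧ (linCombExpr q x l).2.eval s = .int b ∧
      0 < b ∧ (a : ℚ) / b = (l.map fun i => q i * r i).sum := by
  induction l with
  | nil => exact ⟨0, 1, rfl, rfl, by norm_num, by simp⟩
  | cons i l ih =>
    obtain ⟨a, b, h1, h2, h3, h4⟩ := ih fun j hj => h j (by simp [hj])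
    have hi := h i (by simp)
    refine ⟨a * ((q i).den * (r i).den) + b * ((q i).num * (r i).num),
      b * ((q i).den * (r i).den), ?_, ?_, ?_, ?_⟩
    · simp [linCombExpr, Expr.eval, h1, h2, hi, encodeRat, Val.toInt, Val.fst, Val.snd]
    · simp [linCombExpr, Expr.eval, h2, hi, encodeRat, Val.toInt, Val.snd]
    · have := (q i).den_pos
      have := (r i).den_pos
      positivity
    · rw [List.map_cons, List.sum_cons, ← h4]
      have e1 : ((q i).den : ℚ) ≠ 0 := by exact_mod_cast (q i).den_nz
      have e2 : ((r i).den : ℚ) ≠ 0 := by exact_mod_cast (r i).den_nz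
      have e3 : (b : ℚ) ≠ 0 := by exact_mod_cast h3.ne'
      have e4 := Rat.mul_den_eq_num (q i)
      have e5 := Rat.mul_den_eq_num (r i)
      push_cast
      rw [← e4, ← e5]
      field_simp
      ring

/-! ### Reduction to lowest terms -/

/-- One step of the Euclidean algorithm on the pair in register `7`. -/
def euclidStep : Program :=
  .assign 7 (.pair (.snd (.reg 7))
    (.sub (.fst (.reg 7)) (.mul (.div (.fst (.reg 7)) (.snd (.reg 7))) (.snd (.reg 7)))))

/-- Prepends a quotient, in lowest terms, to the list in register `8`. -/
def reduceProgram (e f : Expr) : Program :=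
  .seq (.assign 5 (.pair e f))
    (.seq (.assign 7 (.pair (.snd (.reg 5))
      (.sub (.fst (.reg 5)) (.mul (.div (.fst (.reg 5)) (.snd (.reg 5))) (.snd (.reg 5))))))
      (.seq (.while (.snd (.reg 7)) euclidStep)
        (.assign 8 (.pair (.pair (.div (.fst (.reg 5)) (.fst (.reg 7)))
          (.div (.snd (.reg 5)) (.fst (.reg 7)))) (.reg 8)))))

theorem encodeRat_div {a b : ℤ} (hb : 0 < b) :
    encodeRat ((a : ℚ) / b) = .pair (.int (a / Int.gcd a b)) (.int (b / Int.gcd a b)) := by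
  have hg : 0 < Int.gcd a b := Int.gcd_pos_of_ne_zero_right _ hb.ne'
  obtain ⟨u, hu⟩ := Int.gcd_dvd_left (a := a) (b := b)
  obtain ⟨v, hv⟩ := Int.gcd_dvd_right (a := a) (b := b)
  have hcop := Int.gcd_div_gcd_div_gcd hg
  set g := Int.gcd a b
  have hg' : (g : ℤ) ≠ 0 := by exact_mod_cast hg.ne'
  have hgq : (g : ℚ) ≠ 0 := by exact_mod_cast hg.ne'
  have hau : a / g = u := by rw [hu, Int.mul_ediv_cancel_left _ hg']
  have hbv : b / g = v := by rw [hv, Int.mul_ediv_cancel_left _ hg']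
  rw [hau, hbv] at hcop
  rw [hau, hbv]
  have hv0 : 0 < v := by
    have : 0 < (g : ℤ) * v := hv ▸ hb
    exact pos_of_mul_pos_right this (by positivity)
  have hq : (a : ℚ) / b = (u : ℚ) / v := by
    rw [hu, hv]; push_cast
    exact mul_div_mul_left _ _ hgq
  have hc : Nat.Coprime u.natAbs v.natAbs := hcop
  rw [encodeRat, hq, Rat.num_div_eq_of_coprime hv0 hc, Rat.den_div_eq_of_coprime hv0 hc]

theorem realizes_reduceProgram {I : Type*} {orc : I → Val → Val} {sz : I → ℕ} (e f : Expr)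
    (a b : I → ℤ) (tl : I → Val) (hb : ∀ i, 0 < b i) :
    Realizes orc sz
      (fun i s => e.eval s = .int (a i) ∧ f.eval s = .int (b i) ∧ s 8 = tl i)
      (reduceProgram e f)
      (fun i s => s 8 = .pair (encodeRat ((a i : ℚ) / b i)) (tl i)) := by
  let Inv : I → ℤ × ℤ → State → Prop := fun i p s =>
    s 5 = .pair (.int (a i)) (.int (b i)) ∧ s 8 = tl i ∧ s 7 = .pair (.int p.1) (.int p.2) ∧
      0 ≤ p.2 ∧ p.2 < p.1 ∧ p.1 ≤ b i ∧ Int.gcd p.1 p.2 = Int.gcd (a i) (b i)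
  have hloop := Realizes.while_loop (orc := orc) (sz := sz) (α := fun _ => ℤ × ℤ)
    -- The measure is the bit length of the product of the two numbers, so the number of iterations
    -- is polynomial in the input length.
    (e := .snd (.reg 7)) (c := euclidStep) Inv (fun _ p => (p.1 * p.2).natAbs.size) ?_ ?_
  · refine Realizes.seq ((Realizes.assign _ _).mono (P' := fun i s => e.eval s = .int (a i) ∧
      f.eval s = .int (b i) ∧ s 8 = tl i)
      (Q := fun i s => s 5 = .pair (.int (a i)) (.int (b i)) ∧ s 8 = tl i) ?_ fun _ _ h => h)
      (Realizes.seq ((Realizes.assign _ _).mono ?_ fun _ _ h => h)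
        (Realizes.seq hloop ((Realizes.assign _ _).mono ?_ fun _ _ h => h)))
    · rintro i s ⟨h1, h2, h3⟩
      simp [Expr.eval, h1, h2, h3]
    · rintro i s ⟨h5, h8⟩
      have hb' := hb i
      -- One division before the loop removes the sign of `a` and establishes `0 ≤ y < x ≤ b`.
      refine ⟨(b i, a i % b i), by simpa using h5, by simpa using h8, ?_,
        Int.emod_nonneg _ hb'.ne', Int.emod_lt_of_pos _ hb', le_rfl, ?_⟩
      · simp [Expr.eval, h5, Val.fst, Val.snd, Val.toInt, Int.emod_def, mul_comm]
      · simp only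
        rw [Int.gcd_comm, Int.gcd_emod]
    · rintro i s ⟨⟨x, y⟩, ⟨h5, h8, h7, h1, h2, h3, h4⟩, he⟩
      simp only [Expr.eval, h7, Val.snd, Val.int.injEq] at he
      simp only at h1 h2 h3 h4 h7
      subst he
      rw [Int.gcd_zero_right] at h4
      have hx : x = Int.gcd (a i) (b i) := by omega
      simp [Expr.eval, h5, h7, h8, Val.fst, Val.snd, Val.toInt, encodeRat_div (hb i), hx]
  · intro B
    refine ⟨Polynomial.C 2 * B + 3, ?_⟩
    rintro i ⟨x, y⟩ s ⟨h5, h8, h7, h1, h2, h3, h4⟩ hB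
    simp only at h1 h2 h3 h4 h7
    have h := hB 5 (by simp [Program.writes, euclidStep])
    rw [h5] at h
    simp only [Val.size] at h
    have e1 : x.natAbs.size ≤ (b i).natAbs.size := Nat.size_le_size (by omega)
    have e2 : y.natAbs.size ≤ (b i).natAbs.size := Nat.size_le_size (by omega)
    have e3 := size_mul_natAbs_le x y
    simp only [Polynomial.eval_mul, Polynomial.eval_C, Polynomial.eval_add, Polynomial.eval_ofNat]
    refine ⟨fun z hz => ?_, by omega⟩
    obtain rfl : z = 7 := by simpa [Program.writes, euclidStep] using hz
    rw [h7]
    simp only [Val.size]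
    omega
  · refine (Realizes.assign _ _).mono ?_ fun _ _ h => h
    rintro ⟨i, x, y⟩ s ⟨⟨h5, h8, h7, h1, h2, h3, h4⟩, he⟩
    simp only at h1 h2 h3 h4 h5 h7 h8
    have hy : 0 < y := by
      refine lt_of_le_of_ne h1 ?_
      rintro rfl
      simp [Expr.eval, h7, Val.snd] at he
    have hm0 := Int.emod_nonneg x hy.ne'
    have hm1 := Int.emod_lt_of_pos x hy
    -- As `y < x`, the quotient is at least `1`, so `x ≥ y + x % y > 2 * (x % y)`. Hence the product
    -- more than halves and loses a bit.
    have hd : 2 * (x % y) < x := by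
      have q1 : 1 ≤ x / y := by
        rw [Int.le_ediv_iff_mul_le hy]; omega
      have q2 := Int.emod_add_mul_ediv x y
      nlinarith
    refine ⟨(y, x % y), ?_, by simpa using h5, by simpa using h8, ?_, hm0, hm1, by
      simp only; omega, ?_⟩
    · simp only
      have hlt : 2 * (y * (x % y)).natAbs < (x * y).natAbs := by
        zify
        rw [abs_of_nonneg (by positivity), abs_of_pos (by nlinarith)]
        nlinarith
      have hpos : 0 < (x * y).natAbs.size := Nat.size_pos.mpr (by omega)
      obtain ⟨n, hn⟩ : ∃ n, (x * y).natAbs.size = n + 1 := ⟨_, (Nat.succ_pred_eq_of_pos hpos).symm⟩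
      rw [hn, Nat.lt_succ_iff, Nat.size_le]
      have := Nat.lt_size_self (x * y).natAbs
      rw [hn, pow_succ] at this
      omega
    · simp [Expr.eval, h7, Val.fst, Val.snd, Val.toInt, Int.emod_def, mul_comm]
    · simp only
      rw [← h4, Int.gcd_comm, Int.gcd_emod]


/-! ### The reductions -/

section Reductions

variable {m : ℕ} {θ : ℂ} {A : Matrix (Fin m) (Fin m) ℂ} {D : Matrix (Fin m) (Fin m) ℝ}

/-- The same encoding is passed to the oracle and its answer is returned; the linear length bound
pays for the query. -/
theorem polyTimeReducible_evalNoPin_evalPin (h : IsCommonGenerator θ A D) :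
    PolyTimeReducible (evalNoPin θ A D) (evalPin θ A D) := by
  obtain ⟨q, hq⟩ := exists_size_partitionFunction_le h
  refine ⟨.query 0 (.reg 0), 2 + Polynomial.X + Polynomial.C q * Polynomial.X,
    fun O hO x => ⟨_, _, .query _ _ _, ?_, ?_⟩⟩
  · have h1 := hq x.1 _ (hO x.1)
    simp only [Polynomial.eval_add, Polynomial.eval_X, Polynomial.eval_mul, Polynomial.eval_C,
      Polynomial.eval_ofNat, Expr.eval, Expr.cost, initState, if_true]
    change _ ≤ 2 + x.1.encode.size + q * x.1.encode.size
    change 1 + (1 + x.1.encode.size) + (O x.1.encode).size ≤ _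
    have h1' : (O x.1.encode).size ≤ q * x.1.encode.size := h1
    omega
  · simp only [Function.update_self, Expr.eval, initState, if_true]
    exact hO x.1

/-- The partition function of a digraph with pinning as a linear combination, with constant
coefficients in the number field, of partition functions without pinning. -/
theorem exists_partitionFunction_eq_sum (h : IsCommonGenerator θ A D) (hD : ∀ i, 0 < D i i) :
    ∃ (n : ℕ) (c : ℕ → ℂ) (H : ℕ → Σ h : ℕ, List ((Fin m ⊕ Fin h) × (Fin m ⊕ Fin h))),
      (∀ j, c j ∈ IntermediateField.adjoin ℚ {θ}) ∧ ∀ G : PinnedDigraph m,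
        partitionFunction A (D.map Complex.ofReal) G =
          ∑ j ∈ Finset.range n, c j *
            partitionFunction A (D.map Complex.ofReal) (G.extend (H j)) := by
  -- The indicator is built over the number field rather than `ℂ`, so that its coefficients have
  -- rational coordinates which the program can contain as constants.
  let K := IntermediateField.adjoin ℚ {θ}
  let A' : Matrix (Fin m) (Fin m) K := fun i j => ⟨A i j, (h.2 i j).1⟩
  let D' : Matrix (Fin m) (Fin m) K := fun i j => ⟨((D i j : ℝ) : ℂ), (h.2 i j).2⟩
  have hA' : A'.map (algebraMap K ℂ) = A := rfl
  have hD' : D'.map (algebraMap K ℂ) = D.map Complex.ofReal := rfl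
  obtain ⟨n, c, H, hc⟩ := exists_pinning_combination A' D' (by
    intro S hS h0
    have h1 : ∑ ψ ∈ S, ∏ i, ((D (ψ i) (ψ i) : ℝ) : ℂ) = 0 := by
      have := congrArg (algebraMap K ℂ) h0
      simp only [map_sum, map_prod, map_zero] at this
      exact this
    have h2 : ∑ ψ ∈ S, ∏ i, D (ψ i) (ψ i) = 0 := by exact_mod_cast h1
    exact (Finset.sum_pos (fun ψ _ => Finset.prod_pos fun i _ => hD (ψ i)) hS).ne' h2)
  refine ⟨n, fun j => (c j : ℂ), H, fun j => (c j).2, fun G => ?_⟩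
  rw [partitionFunction_eq_labelledSum]
  have := congrArg (algebraMap K ℂ) (hc _ G.labelledEdges)
  simp only [map_sum, map_mul, map_prod, map_labelledSum, hA', hD'] at this
  rw [this]
  refine Finset.sum_congr rfl fun j _ => ?_
  rw [partitionFunction_extend]
  rfl

/-- The program that evaluates a partition function with pinning: it renumbers the vertices, asks
`n` queries, and computes the `d` coordinates of a linear combination of the answers. -/
noncomputable def pinProgram (m n d : ℕ)
    (H : ℕ → Σ h : ℕ, List ((Fin m ⊕ Fin h) × (Fin m ⊕ Fin h))) (M : ℕ → ℕ → ℕ → ℚ) : Program :=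
  let E : ℕ → Expr × Expr := fun k =>
    linCombExpr (fun p : ℕ × ℕ => M p.1 p.2 k) (fun p => nthExpr p.2 (.reg (9 + p.1)))
      (Finset.range n ×ˢ Finset.range d).toList
  .seq scanProgram
    (.seq (edgesProgram m)
      (.seq (.seqRange (fun j => .query (9 + j) (queryExpr m (H j))) n)
        (.seq (.assign 8 (.const 0))
          (.seq (.seqRange (fun k => reduceProgram (E (d - (k + 1))).1 (E (d - (k + 1))).2) d)
            (.assign 0 (.reg 8))))))

/-- Answers are kept from register `9` on, clear of the work registers `0` to `8`. The table `M` is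
to be filled with the coordinates of the coefficients times powers of `θ`. -/
theorem realizes_pinProgram {I : Type*} {orc : I → Val → Val} {sz : I → ℕ} (n d : ℕ)
    (H : ℕ → Σ h : ℕ, List ((Fin m ⊕ Fin h) × (Fin m ⊕ Fin h))) (M : ℕ → ℕ → ℕ → ℚ)
    (G : I → PinnedDigraph m) (x : I → ℕ → ℕ → ℚ)
    (hx : ∀ i j, orc i ((G i).extend (H j)).encode =
      .ofList ((List.range d).map fun k => encodeRat (x i j k)))
    (q : ℕ) (hq : ∀ i j, (orc i ((G i).extend (H j)).encode).size ≤
      q * ((G i).extend (H j)).encode.size) :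
    Realizes orc sz (fun i s => s = initState (G i).encode) (pinProgram m n d H M)
      (fun i s => s 0 = .ofList ((List.range d).map fun k => encodeRat
        (∑ p ∈ Finset.range n ×ˢ Finset.range d, M p.1 p.2 k * x i p.1 p.2))) := by
  have hscan := (realizes_scanProgram (orc := orc) (sz := sz) G).frame
    (R := fun i s => s 3 = .int 0 ∧ s 4 = .int 0) (by
      rintro i s s' hs ⟨h3, h4⟩
      exact ⟨by rw [hs 3 (by simp [scanProgram, Program.writes]), h3],
        by rw [hs 4 (by simp [scanProgram, Program.writes]), h4]⟩)
  have hedges := (realizes_edgesProgram (orc := orc) (sz := sz) G).frame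
    (R := fun i s => s 1 = (G i).scanned (G i).n) (by
      rintro i s s' hs h1
      rw [hs 1 (by simp [edgesProgram, lookupProgram, Program.writes]), h1])
  have hquery := Realizes.seqRange (orc := orc) (sz := sz)
    (c := fun j => .query (9 + j) (queryExpr m (H j)))
    (P := fun j i s => s 1 = (G i).scanned (G i).n ∧
      s 2 = .pair (.int 0) (.ofList ((G i).edges.reverse.map (G i).newEdge)) ∧
      ∀ l < j, s (9 + l) = orc i ((G i).extend (H l)).encode) n (by
    intro j _
    refine Realizes.query _ _ (fun b => ?_) ?_
    -- The query is no longer than the time to build it, and the answer at most `q` times as long as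
    -- the query.
    · refine ⟨Polynomial.C (q * (queryExpr m (H j)).weight) * b, ?_⟩
      rintro i s ⟨h1, h2, -⟩ hb
      have e1 := Expr.cost_le hb (queryExpr m (H j))
      have e2 := Expr.size_eval_lt_cost s (queryExpr m (H j))
      rw [eval_queryExpr (G i) (H j) h1 h2] at e2 ⊢
      refine (hq i j).trans ?_
      simp only [Polynomial.eval_mul, Polynomial.eval_C]
      rw [mul_assoc]
      exact Nat.mul_le_mul_left _ (by omega)
    · rintro i s ⟨h1, h2, h⟩
      refine ⟨by rw [Function.update_of_ne (by omega), h1],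
        by rw [Function.update_of_ne (by omega), h2], fun l hl => ?_⟩
      by_cases hlj : l = j
      · subst hlj
        rw [Function.update_self, eval_queryExpr (G i) (H l) h1 h2]
      · rw [Function.update_of_ne (by omega)]
        exact h l (by omega))
  let y : I → ℕ → ℚ := fun i k =>
    ∑ p ∈ Finset.range n ×ˢ Finset.range d, M p.1 p.2 k * x i p.1 p.2
  have hreduce := Realizes.seqRange (orc := orc) (sz := sz)
    (c := fun k => reduceProgram
      (linCombExpr (fun p : ℕ × ℕ => M p.1 p.2 (d - (k + 1)))
        (fun p => nthExpr p.2 (.reg (9 + p.1))) (Finset.range n ×ˢ Finset.range d).toList).1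
      (linCombExpr (fun p : ℕ × ℕ => M p.1 p.2 (d - (k + 1)))
        (fun p => nthExpr p.2 (.reg (9 + p.1))) (Finset.range n ×ˢ Finset.range d).toList).2)
    -- Lists grow at the head, so the coordinates are produced from the last to the first.
    (P := fun k i s => s 8 = .ofList ((List.range' (d - k) k).map fun k => encodeRat (y i k)) ∧
      ∀ l < n, s (9 + l) = orc i ((G i).extend (H l)).encode) d (by
    intro k hk
    let tl : I → Val := fun i =>
      .ofList ((List.range' (d - k) k).map fun k => encodeRat (y i k))
    set e := linCombExpr (fun p : ℕ × ℕ => M p.1 p.2 (d - (k + 1)))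
        (fun p => nthExpr p.2 (.reg (9 + p.1))) (Finset.range n ×ˢ Finset.range d).toList with he
    -- The unreduced numerator and denominator depend on the answers in the registers; they enter as
    -- part of the index.
    have h1 := (realizes_reduceProgram
      (I := (i : I) × {p : ℤ × ℤ // 0 < p.2 ∧ (p.1 : ℚ) / p.2 = y i (d - (k + 1))})
      (orc := fun p => orc p.1) (sz := fun p => sz p.1) e.1 e.2 (fun p => p.2.1.1)
      (fun p => p.2.1.2) (fun p => tl p.1) (fun p => p.2.2.1)).frame
      (R := fun p s => ∀ l < n, s (9 + l) = orc p.1 ((G p.1).extend (H l)).encode) (by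
        intro p s s' hs hR l hl
        rw [hs (9 + l) (by simp [reduceProgram, euclidStep, Program.writes]; omega), hR l hl])
    refine (Realizes.exists_index
      (α := fun i => {p : ℤ × ℤ // 0 < p.2 ∧ (p.1 : ℚ) / p.2 = y i (d - (k + 1))})
      (P := fun i p s => (e.1.eval s = .int p.1.1 ∧ e.2.eval s = .int p.1.2 ∧ s 8 = tl i) ∧
        ∀ l < n, s (9 + l) = orc i ((G i).extend (H l)).encode)
      (Q := fun i p s => s 8 = .pair (encodeRat ((p.1.1 : ℚ) / p.1.2)) (tl i) ∧
        ∀ l < n, s (9 + l) = orc i ((G i).extend (H l)).encode) h1).mono ?_ ?_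
    · rintro i s ⟨h8, hl⟩
      obtain ⟨a, b, ha, hb, hb0, hab⟩ := eval_linCombExpr
        (fun p : ℕ × ℕ => M p.1 p.2 (d - (k + 1))) (fun p => nthExpr p.2 (.reg (9 + p.1)))
        (fun p => x i p.1 p.2) (s := s) (Finset.range n ×ˢ Finset.range d).toList (by
          intro p hp
          simp only [Finset.mem_toList, Finset.mem_product, Finset.mem_range] at hp
          rw [eval_nthExpr (l := (List.range d).map fun k => encodeRat (x i p.1 k))
            (by simp only [Expr.eval]; rw [hl _ hp.1, hx]) (by simpa using hp.2)]
          simp)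
      exact ⟨⟨(a, b), hb0, by rw [hab, Finset.sum_map_toList]⟩, ⟨ha, hb, h8⟩, hl⟩
    · rintro i s ⟨⟨p, hp0, hp⟩, h8, hl⟩
      refine ⟨?_, hl⟩
      rw [h8, hp, List.range'_succ, show d - (k + 1) + 1 = d - k by omega]
      rfl)
  refine Realizes.seq (hscan.mono ?_ fun _ _ h => h)
    (Realizes.seq (hedges.mono ?_ fun _ _ h => h)
      (Realizes.seq (hquery.mono ?_ fun _ _ h => h)
        (Realizes.seq ((Realizes.assign _ _).mono ?_ fun _ _ h => h)
          (Realizes.seq hreduce ((Realizes.assign _ _).mono ?_ fun _ _ h => h)))))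
  · rintro i s rfl
    simp [initState]
  · rintro i s ⟨⟨h0, h1⟩, h3, h4⟩
    exact ⟨⟨h0, h3, h4⟩, h1⟩
  · rintro i s ⟨h2, h1⟩
    exact ⟨h1, h2, fun l hl => absurd hl (by omega)⟩
  · rintro i s ⟨-, -, h⟩
    refine ⟨by simp [Expr.eval, Val.ofList], fun l hl => ?_⟩
    rw [Function.update_of_ne (by omega)]
    exact h l hl
  · rintro i s ⟨h8, -⟩
    rw [Function.update_self, Expr.eval, h8, Nat.sub_self, List.range_eq_range']

theorem polyTimeReducible_evalPin_evalNoPin (h : IsCommonGenerator θ A D)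
    (hD : ∀ i, 0 < D i i) : PolyTimeReducible (evalPin θ A D) (evalNoPin θ A D) := by
  classical
  obtain ⟨q, hq⟩ := exists_size_partitionFunction_le h
  obtain ⟨n, c, H, hc, hZ⟩ := exists_partitionFunction_eq_sum h hD
  let d := (minpoly ℚ θ).natDegree
  -- Multiplication by the constant `c j` is a rational linear map in the power basis; these
  -- coordinates form its matrix.
  choose M' hM' using fun j (i : ℕ) => exists_coords h.1
    (mul_mem (hc j) (pow_mem (IntermediateField.mem_adjoin_simple_self ℚ θ) i))
  let M : ℕ → ℕ → ℕ → ℚ := fun j i k => if hk : k < d then M' j i ⟨k, hk⟩ else 0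
  have hM : ∀ j i, c j * θ ^ i = ∑ k ∈ Finset.range d, (M j i k : ℂ) * θ ^ k := by
    intro j i
    rw [hM' j i, Finset.sum_range]
    exact Finset.sum_congr rfl fun k _ => by simp [M, d]
  -- Oracle and input together form the index, so one polynomial bounds the time for every correct
  -- oracle.
  let I : Type := {O : Val → Val // (evalNoPin θ A D).SolvedBy O} × PinnedDigraph m
  have hans : ∀ (i : I) (j : ℕ), IsStandardRep θ
      (partitionFunction A (D.map Complex.ofReal) (i.2.extend (H j)))
      (i.1.1 (i.2.extend (H j)).encode) :=
    fun i j => i.1.2 ⟨i.2.extend (H j), fun _ => rfl⟩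
  choose x' hx1 hx2 using hans
  let x : I → ℕ → ℕ → ℚ := fun i j k => if hk : k < d then x' i j ⟨k, hk⟩ else 0
  have hx : ∀ (i : I) (j : ℕ), i.1.1 (i.2.extend (H j)).encode =
      .ofList ((List.range d).map fun k => encodeRat (x i j k)) := by
    intro i j
    rw [hx2 i j, ← List.map_coe_finRange_eq_range, List.map_map, List.ofFn_eq_map]
    congr 1
    exact List.map_congr_left fun k _ => by simp [x, d]
  have hxZ : ∀ (i : I) (j : ℕ), partitionFunction A (D.map Complex.ofReal) (i.2.extend (H j)) =
      ∑ k ∈ Finset.range d, (x i j k : ℂ) * θ ^ k := by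
    intro i j
    rw [hx1 i j, Finset.sum_range]
    exact Finset.sum_congr rfl fun k _ => by simp [x, d]
  obtain ⟨p, hp⟩ := realizes_pinProgram (orc := fun i : I => i.1.1)
    (sz := fun i => i.2.encode.size) n d H M (fun i => i.2) x hx q
    (fun i j => hq _ _ (i.1.2 ⟨i.2.extend (H j), fun _ => rfl⟩)) Polynomial.X
  refine ⟨pinProgram m n d H M, p, fun O hO (G : PinnedDigraph m) => ?_⟩
  obtain ⟨s, t, h1, h2, h3⟩ := hp (⟨O, hO⟩, G) (initState G.encode) rfl (by
    intro r
    simp only [Polynomial.eval_X, initState]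
    split_ifs
    · exact le_rfl
    · exact Val.one_le_size _)
  refine ⟨s, t, h1, h2, fun k => ∑ p ∈ Finset.range n ×ˢ Finset.range d,
    M p.1 p.2 k * x (⟨O, hO⟩, G) p.1 p.2, ?_, ?_⟩
  · rw [hZ G]
    calc ∑ j ∈ Finset.range n, c j *
          partitionFunction A (D.map Complex.ofReal) (G.extend (H j))
        = ∑ j ∈ Finset.range n, ∑ i ∈ Finset.range d, ∑ k ∈ Finset.range d,
            ((M j i k * x (⟨O, hO⟩, G) j i : ℚ) : ℂ) * θ ^ k := by
          refine Finset.sum_congr rfl fun j _ => ?_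
          rw [hxZ (⟨O, hO⟩, G) j, Finset.mul_sum]
          refine Finset.sum_congr rfl fun i _ => ?_
          rw [mul_left_comm, hM, Finset.mul_sum]
          refine Finset.sum_congr rfl fun k _ => ?_
          push_cast; ring
      _ = ∑ k ∈ Finset.range d, ∑ p ∈ Finset.range n ×ˢ Finset.range d,
            ((M p.1 p.2 k * x (⟨O, hO⟩, G) p.1 p.2 : ℚ) : ℂ) * θ ^ k := by
          symm
          rw [Finset.sum_comm, Finset.sum_product]
      _ = _ := by
          rw [Finset.sum_range]
          refine Finset.sum_congr rfl fun k _ => ?_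
          rw [← Finset.sum_mul]
          push_cast
          rfl
  · rw [h3, ← List.map_coe_finRange_eq_range, List.map_map, List.ofFn_eq_map]
    rfl

end Reductions

end PartitionFunction

theorem mainTheorem5 (m : ℕ) (A : Matrix (Fin m) (Fin m) ℂ) (D : Matrix (Fin m) (Fin m) ℝ)
    (hA : A.IsHermitian) (hAalg : ∀ i j, IsAlgebraic ℚ (A i j))
    (hD : D.IsDiag) (hDpos : ∀ i, 0 < D i i) (hDalg : ∀ i, IsAlgebraic ℚ (D i i)) :
    (∃ θ : ℂ, PartitionFunction.IsCommonGenerator θ A D) ∧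
    ∀ θ : ℂ, PartitionFunction.IsCommonGenerator θ A D →
      PartitionFunction.PolyTimeEquivalent
        (PartitionFunction.evalPin θ A D) (PartitionFunction.evalNoPin θ A D) :=
  ⟨PartitionFunction.exists_commonGenerator A D hAalg hD hDalg, fun _ h =>
    ⟨PartitionFunction.polyTimeReducible_evalPin_evalNoPin h hDpos,
      PartitionFunction.polyTimeReducible_evalNoPin_evalPin h⟩⟩
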